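/- **Theorem (existence of a common trends representation).** Let $\mathcal H$ be a separable complex Hilbert space, $A^\circ_1,\dots,A^\circ_k$ bounded linear operators on $\mathcal H$ and $A(z)=I-\sum_{h=1}^kA^\circ_hz^h$. Suppose that $A(L)x_t=\varepsilon_t$ is an AR with a unit root of finite type: for some $\rho>1$, $A(z)$ is invertible for $|z|<\rho$, $z\neq1$, while $A(1)$ is a Fredholm operator (finite-dimensional kernel, closed range of finite codimension) with nonzero kernel. Then there are an integer $d\ge1$ and bounded operators $C_0,\dots,C_{d-1}$ of finite rank, $C_0\neq0$, and $C^\star_{j}$, $j\ge0$, depending only on $A$, with $\sum_{j}\|C^\star_j\||z|^j<\infty$ for $|z|<\rho$, such that, with $C_d^\star(z)=\sum_{j\ge0}C^\star_jz^j$, $$A(z)^{-1}=\sum_{n=0}^{d-1}C_n(1-z)^{n-d}+C_d^\star(z),\qquad |z|<\rho,\ z\neq1;$$ in particular $A(z)^{-1}$ has a pole of order exactly $d$ at $z=1$. Let $\{\varepsilon_t\}_{t\in\mathbb Z}$ be $\mathcal H$-valued white noise: square integrable with $E\|\varepsilon_t\|^2>0$, $E\varepsilon_t=0$, covariance operator not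 depending on $t$, and $\varepsilon_t,\varepsilon_s$ uncorrelated for $s\ne t$. Let $\{x_t\}_{t\in\mathbb Z}$ be an $\mathcal H$-valued process on the same probability space with $x_t=\sum_{h=1}^kA^\circ_hx_{t-h}+\varepsilon_t$ almost surely for all $t\in\mathbb Z$, that is not explosive in the remote past: for some $0<r<\rho$, $r^{-n}x_{-n}\to0$ in probability as $n\to\infty$. Then, almost surely, for all $t\in\mathbb Z$, $$x_t=C_0s_{d,t}+C_1s_{d-1,t}+\dots+C_{d-1}s_{1,t}+y_t+\mu_t .$$ Here * $s_{h,t}=\mathcal S^h\varepsilon_t$, where $\mathcal Sw_t=\sum_{i=1}^tw_i$ for $t\ge1$, $\mathcal Sw_0=0$ and $\mathcal Sw_t=-\sum_{i=t+1}^0w_i$ for $t\le-1$; so $s_{1,t}$ is a bilateral random walk and $s_{h,t}$ its $(h-1)$-fold cumulation. For every $h\ge1$, $s_{h,t}\sim I(h)$, that is, $\Delta^hs_{h,t}-E(\Delta^hs_{h,t})=B(L)\varepsilon_t$ with $B_0=I$, $B(1)\ne0$ and $\sum_j\|B_j\|R^j<\infty$ for some $R>1$; * $y_t=C_d^\star(L)\varepsilon_t=\sum_{j\ge0}C^\star_j\varepsilon_{t-j}$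 is a linear process, the series converging in mean square and, almost surely, absolutely (its leading coefficient $C^\star_0$ need not be $I$); * $\mu_t=\sum_{n=0}^{d-1}v_nt^n$ is a polynomial in $t$ of degree less than $d$ whose coefficients $v_0,\dots,v_{d-1}$ are the images of the initial values $(x_t,y_t,\varepsilon_t)_{-d\le t\le0}$ under bounded linear maps that depend only on $A$. If all $x_t$ are integrable, then so are the $v_n$, and $E(x_t)=E(\mu_t)=\sum_{n=0}^{d-1}E(v_n)t^n$ for all $t$; if the $v_n$ are almost surely equal to constants, then every $x_t$ is integrable and $E(x_t)=\mu_t$. -/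

import Mathlib

open MeasureTheory Filter Topology

noncomputable section

namespace HilbertAR

section Operators

variable {H : Type*} [NormedAddCommGroup H] [InnerProductSpace ℂ H]

/-- The operator function `A(z) = I - ∑_{h=1}^k A°_h z^h`; the operator `A°_h` is `a (h - 1)`. -/
def arPoly {k : ℕ} (a : Fin k → H →L[ℂ] H) (z : ℂ) : H →L[ℂ] H :=
  1 - ∑ h : Fin k, z ^ ((h : ℕ) + 1) • a h

/-- `z₀` is an eigenvalue of finite type of the operator function `W`: the operator `W z₀` is
Fredholm and not injective, and `W` is invertible on a punctured disc around `z₀`. -/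
structure IsEigenvalueOfFiniteType (W : ℂ → H →L[ℂ] H) (z₀ : ℂ) : Prop where
  fredholm : (W z₀).IsFredholm
  exists_ker : ∃ v : H, v ≠ 0 ∧ W z₀ v = 0
  invertible_near : ∃ δ > 0, ∀ z ∈ Metric.ball z₀ δ, z ≠ z₀ → IsUnit (W z)

/-- The autoregression with operators `a` has a unit root of finite type at `z = 1`, with
`A(z)` invertible on the punctured disc `D(0, ρ) \ {1}`, `ρ > 1`. -/
structure IsUnitRootOfFiniteType {k : ℕ} (a : Fin k → H →L[ℂ] H) (ρ : ℝ) : Prop where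
  one_lt : 1 < ρ
  eigenvalue : IsEigenvalueOfFiniteType (arPoly a) 1
  invertible : ∀ z ∈ Metric.ball (0 : ℂ) ρ, z ≠ 1 → IsUnit (arPoly a z)

/-- The power series `∑ B_n z^n` is absolutely convergent on the open disc `D(0, ρ)`. -/
def AbsConvOn (B : ℕ → H →L[ℂ] H) (ρ : ℝ) : Prop :=
  ∀ z ∈ Metric.ball (0 : ℂ) ρ, Summable fun n => ‖B n‖ * ‖z‖ ^ n

end Operators

section Lags

/-- The difference operator `Δ = 1 - L`. -/
def diffOp {V : Type*} [AddCommGroup V] (w : ℤ → V) : ℤ → V :=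
  fun t => w t - w (t - 1)

/-- The integral (cumulation) operator `𝒮`. -/
def cumOp {V : Type*} [AddCommGroup V] (w : ℤ → V) : ℤ → V :=
  fun t =>
    if 1 ≤ t then ∑ i ∈ Finset.Icc 1 t, w i
    else if t ≤ -1 then -∑ i ∈ Finset.Icc (t + 1) 0, w i
    else 0

/-- `s_{h,t} = 𝒮^h ε_t`, the `(h-1)`-fold cumulation of the bilateral random walk `s_{1,t}`. -/
def commonTrend {V : Type*} [AddCommGroup V] (ε : ℤ → V) (h : ℕ) : ℤ → V :=
  cumOp^[h] ε

end Lags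

section Processes

variable {H : Type*} [NormedAddCommGroup H] [InnerProductSpace ℂ H]
  {Ω : Type*} [MeasurableSpace Ω]

/-- Covariance operator `w ↦ E(⟨w, Z⟩ Z)`. Mathlib's inner product is conjugate-linear in its
first argument, so that the expression below is linear in `w`. -/
def covOp (P : Measure Ω) (Z : Ω → H) (w : H) : H :=
  ∫ ω, inner ℂ (Z ω) w • Z ω ∂P

/-- Cross-covariance function `c_{Z,U}(v, w)` of two `H`-valued random variables. -/
def crossCov (P : Measure Ω) (Z U : Ω → H) (v w : H) : ℂ :=
  ∫ ω, inner ℂ v (Z ω - ∫ ω', Z ω' ∂P) *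
    (starRingEnd ℂ) (inner ℂ w (U ω - ∫ ω', U ω' ∂P)) ∂P

/-- Weakly stationary `H`-valued process. -/
structure IsWeaklyStationary [MeasurableSpace H] (P : Measure Ω) (ε : ℤ → Ω → H) : Prop where
  measurable : ∀ t, Measurable (ε t)
  memLp : ∀ t, MemLp (ε t) 2 P
  second_moment_pos : ∀ t, 0 < ∫ ω, ‖ε t ω‖ ^ 2 ∂P
  mean_const : ∀ s t, ∫ ω, ε s ω ∂P = ∫ ω, ε t ω ∂P
  covOp_const : ∀ s t, covOp P (ε s) = covOp P (ε t)
  crossCov_shift : ∀ s t u, crossCov P (ε t) (ε s) = crossCov P (ε (t + u)) (ε (s + u))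

/-- `H`-valued white noise. -/
structure IsWhiteNoise [MeasurableSpace H] (P : Measure Ω) (ε : ℤ → Ω → H) : Prop where
  weaklyStationary : IsWeaklyStationary P ε
  mean_zero : ∀ t, ∫ ω, ε t ω ∂P = 0
  uncorrelated : ∀ s t, s ≠ t → ∀ v w, crossCov P (ε t) (ε s) v w = 0

/-- `B(L) w_t = ∑_{n ≥ 0} B_n w_{t-n}`, summed path by path. -/
def lagFilter (B : ℕ → H →L[ℂ] H) (w : ℤ → Ω → H) : ℤ → Ω → H :=
  fun t ω => ∑' n : ℕ, B n (w (t - n) ω)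

/-- `u` is a linear process in the white noise `ε` with coefficients `B`: the series `B(z)` is
absolutely convergent on some disc `D(0, ρ)` with `ρ > 1`, and
`u_t - E(u_t) = ∑_{n ≥ 0} B_n ε_{t-n}` in mean square. The normalization `B_0 = I` is not part of
this definition; see `IsIZero`. -/
structure IsLinearProcess [MeasurableSpace H] (P : Measure Ω) (ε : ℤ → Ω → H)
    (B : ℕ → H →L[ℂ] H) (u : ℤ → Ω → H) : Prop where
  whiteNoise : IsWhiteNoise P ε
  absConv : ∃ ρ : ℝ, 1 < ρ ∧ AbsConvOn B ρ
  integrable : ∀ t, Integrable (u t) P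
  meanSquare : ∀ t, Tendsto
    (fun N : ℕ => eLpNorm (fun ω => (u t ω - ∫ ω', u t ω' ∂P) -
      ∑ n ∈ Finset.range N, B n (ε (t - n) ω)) 2 P) atTop (𝓝 0)

/-- `u ∼ I(0)` in the white noise `ε`: `u_t - E(u_t) = B(L) ε_t` is a linear process with
`B_0 = I` and `B(1) ≠ 0`. -/
def IsIZero [MeasurableSpace H] (P : Measure Ω) (ε : ℤ → Ω → H) (u : ℤ → Ω → H) : Prop :=
  ∃ B : ℕ → H →L[ℂ] H, IsLinearProcess P ε B u ∧ B 0 = 1 ∧ ∑' n, B n ≠ 0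

/-- `u ∼ I(d)` in the white noise `ε`: the `d`-th difference of `u` is `I(0)`. -/
def IsIntegratedOfOrder [MeasurableSpace H] (P : Measure Ω) (ε : ℤ → Ω → H) (d : ℕ)
    (u : ℤ → Ω → H) : Prop :=
  IsIZero P ε (diffOp^[d] u)

/-- `x` is an `H`-valued process that solves the autoregressive equations `A(L) x_t = ε_t`,
`t ∈ ℤ`, that is `x_t = A°_1 x_{t-1} + ⋯ + A°_k x_{t-k} + ε_t` almost surely. -/
structure SolvesAR [MeasurableSpace H] (P : Measure Ω) {k : ℕ} (a : Fin k → H →L[ℂ] H)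
    (ε x : ℤ → Ω → H) : Prop where
  measurable : ∀ t, Measurable (x t)
  equation : ∀ t : ℤ, ∀ᵐ ω ∂P, x t ω = ∑ h : Fin k, a h (x (t - ((h : ℕ) + 1)) ω) + ε t ω

/-- `r^{-n} x_{-n} → 0` in probability as `n → ∞`, for some `0 < r < ρ`: no component of `x`
explodes at the exponential rate `ρ` or faster in the remote past. -/
def NonexplosivePast (P : Measure Ω) (ρ : ℝ) (x : ℤ → Ω → H) : Prop :=
  ∃ r : ℝ, 0 < r ∧ r < ρ ∧
    TendstoInMeasure P (fun (n : ℕ) ω => (r ^ n)⁻¹ • x (-(n : ℤ)) ω) atTop (fun _ => 0)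

/-- The values of `x_t, y_t, ε_t` at the dates `t = 0, -1, …, -d`. -/
def initialValues (d : ℕ) (x y ε : ℤ → Ω → H) (ω : Ω) : Fin (d + 1) → H × H × H :=
  fun j => (x (-((j : ℕ) : ℤ)) ω, y (-((j : ℕ) : ℤ)) ω, ε (-((j : ℕ) : ℤ)) ω)

end Processes

end HilbertAR

end

/-!
As `A(1)` is Fredholm, the inverse `A(z)⁻¹` is meromorphic at `1`: bordering `A(1)` with
a complement of its range and a projection onto its kernel makes it invertible
(`meromorphicAt_inverse_of_isEigenvalueOfFiniteType`), and the blocks of the bordered inverse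
reduce the claim to finite dimension, where Cramer's rule applies
(`meromorphicAt_inverse_of_finiteDimensional`). A finite limit at `1` would make `A(1)` injective,
so there is a pole, of order `d` say. The coefficients of the principal part have finite rank
because `A(z) (z - 1)^d A(z)⁻¹ = (z - 1)^d` forces them, one after the other, to map a subspace of
finite codimension into the finite-dimensional kernel of `A(1)`
(`exists_taylor_of_finiteDimensional_ker`). What remains extends holomorphically over `1` and has
the power series `C⋆` (`exists_laurent_inverse_arPoly`).

For the representation of a solution `x`, put `D(z) = (1 - z)^d A(z)⁻¹`, a power series without
singularity in the disc of radius `ρ`, so that `D(z) A(z) = (1 - z)^d`. Filtering `A(L) x_t = ε_t`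
with the first `N` coefficients of `D` gives `Δ^d x_t` up to boundary terms
(`sum_apply_eq_sub_boundaryTerm`), which involve `x` only near the date `t - N` and vanish along a
subsequence of `N`, almost surely, since `x` does not explode in the past
(`exists_seq_ae_tendsto_block`, `tendsto_boundaryTerm`). Hence `Δ^d x_t = D(L) ε_t`, and the
right-hand side is `Δ^d` of `∑ C_n s_{d-n,t} + y_t`. A sequence whose `d`-th difference vanishes
is a polynomial of degree less than `d`, and Lagrange interpolation at the dates
`0, -1, …, -(d - 1)` expresses its coefficients by the initial values (`eq_sum_pow_smul_of_diffOp_iterate_eq_zero`,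
`trendCoeff`).

The filtered noise `y` is handled by absolute summability, for which `E‖ε_t‖²` must not depend on
`t`; it is the trace of the covariance operator (`IsWeaklyStationary.eLpNorm_eq`). The trends and
`y` have mean zero, which gives the statements on expectations.
-/

namespace HilbertAR

/-! ### Inverting a holomorphic operator function at an eigenvalue of finite type -/

section Meromorphic

theorem analyticAt_clm_comp {E F G : Type*} [NormedAddCommGroup E] [NormedSpace ℂ E]
    [NormedAddCommGroup F] [NormedSpace ℂ F] [NormedAddCommGroup G] [NormedSpace ℂ G]
    {f : ℂ → F →L[ℂ] G} {g : ℂ → E →L[ℂ] F} {z₀ : ℂ}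
    (hf : AnalyticAt ℂ f z₀) (hg : AnalyticAt ℂ g z₀) :
    AnalyticAt ℂ (fun z => (f z).comp (g z)) z₀ :=
  ((ContinuousLinearMap.compL ℂ E F G).analyticAt_bilinear (f z₀, g z₀)).comp₂ hf hg

theorem analyticAt_det {n : Type*} [Fintype n] [DecidableEq n] {M : ℂ → Matrix n n ℂ} {z₀ : ℂ}
    (hM : ∀ i j, AnalyticAt ℂ (fun z => M z i j) z₀) : AnalyticAt ℂ (fun z => (M z).det) z₀ := by
  simp only [Matrix.det_apply, Units.smul_def, zsmul_eq_mul]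
  refine Finset.analyticAt_fun_sum _ fun σ _ => analyticAt_const.mul ?_
  exact Finset.analyticAt_fun_prod _ fun i _ => hM _ _

/-- Cramer's rule: in finite dimension the inverse is a quotient of holomorphic functions. -/
theorem meromorphicAt_inverse_of_finiteDimensional {N : Type*} [NormedAddCommGroup N]
    [NormedSpace ℂ N] [FiniteDimensional ℂ N] {S : ℂ → N →L[ℂ] N} {z₀ : ℂ}
    (hS : AnalyticAt ℂ S z₀) (hu : ∀ᶠ z in 𝓝[≠] z₀, IsUnit (S z)) :
    MeromorphicAt (fun z => Ring.inverse (S z)) z₀ := by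
  classical
  let b := Module.finBasis ℂ N
  let M : ℂ → Matrix _ _ ℂ := fun z => LinearMap.toMatrix b b (S z : N →ₗ[ℂ] N)
  have hM : ∀ i j, AnalyticAt ℂ (fun z => M z i j) z₀ := by
    intro i j
    have : (fun z => M z i j) =
        fun z => LinearMap.toContinuousLinearMap (b.coord i) (S z (b j)) := by
      funext z
      simp [M, LinearMap.toMatrix_apply]
    rw [this]
    exact ((LinearMap.toContinuousLinearMap (b.coord i)).comp
      (ContinuousLinearMap.apply ℂ N (b j))).analyticAt _ |>.comp hS
  have hadj : ∀ i j, AnalyticAt ℂ (fun z => (M z).adjugate i j) z₀ := by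
    intro i j
    simp only [Matrix.adjugate_apply]
    refine analyticAt_det fun p q => ?_
    by_cases hp : p = j
    · subst hp
      simpa using analyticAt_const
    · simpa [Matrix.updateRow_ne hp] using hM p q
  let E : Fin (Module.finrank ℂ N) → Fin (Module.finrank ℂ N) → N →L[ℂ] N := fun i j =>
    LinearMap.toContinuousLinearMap (Matrix.toLin b b (Matrix.single i j 1))
  have key : ∀ᶠ z in 𝓝[≠] z₀,
      ((M z).det)⁻¹ • ∑ i, ∑ j, (M z).adjugate i j • E i j = Ring.inverse (S z) := by
    filter_upwards [hu] with z hz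
    obtain ⟨u, hu⟩ := hz
    have h1 : M z * LinearMap.toMatrix b b ((u⁻¹ : (N →L[ℂ] N)ˣ) : N →ₗ[ℂ] N) = 1 := by
      have h0 : (S z : N →ₗ[ℂ] N) ∘ₗ ((u⁻¹ : (N →L[ℂ] N)ˣ) : N →ₗ[ℂ] N) = LinearMap.id :=
        LinearMap.ext fun x => by
          rw [← hu]
          exact congrArg (fun T : N →L[ℂ] N => T x) u.mul_inv
      rw [← LinearMap.toMatrix_comp, h0, LinearMap.toMatrix_id]
    have h2 := Matrix.inv_eq_right_inv h1
    rw [← hu, Ring.inverse_unit]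
    have h3 : ∑ i, ∑ j, (M z).adjugate i j • E i j =
        LinearMap.toContinuousLinearMap (Matrix.toLin b b (M z).adjugate) := by
      conv_rhs => rw [Matrix.matrix_eq_sum_single (M z).adjugate]
      simp only [map_sum, E]
      refine Finset.sum_congr rfl fun i _ => Finset.sum_congr rfl fun j _ => ?_
      rw [← map_smul, ← map_smul]
      simp [Matrix.smul_single]
    rw [h3, ← map_smul, ← map_smul, ← Ring.inverse_eq_inv', ← Matrix.inv_def, h2,
      Matrix.toLin_toMatrix]
    ext
    simp
  refine MeromorphicAt.congr ?_ key
  exact (analyticAt_det hM).meromorphicAt.inv.smul (Finset.analyticAt_fun_sum _ fun i _ =>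
    Finset.analyticAt_fun_sum _ fun j _ => (hadj i j).smul analyticAt_const).meromorphicAt

variable {H : Type*} [NormedAddCommGroup H] [InnerProductSpace ℂ H] [CompleteSpace H]

/-- If bordering `W z₀` with finitely many dimensions makes it invertible, then the inverse of `W z`
is expressed by the blocks of the inverse of the bordered operator, one of which acts between
finite-dimensional spaces and has to be inverted. -/
theorem meromorphicAt_inverse_of_bordered {N R : Type*} [NormedAddCommGroup N] [NormedSpace ℂ N]
    [FiniteDimensional ℂ N] [NormedAddCommGroup R] [NormedSpace ℂ R] [FiniteDimensional ℂ R]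
    {W : ℂ → H →L[ℂ] H} {z₀ : ℂ} (hW : AnalyticAt ℂ W z₀) (hinv : ∀ᶠ z in 𝓝[≠] z₀, IsUnit (W z))
    (ι : R →L[ℂ] H) (P : H →L[ℂ] N) (e : (H × R) ≃L[ℂ] (H × N))
    (he : ∀ x y, e (x, y) = (W z₀ x + ι y, P x)) :
    MeromorphicAt (fun z => Ring.inverse (W z)) z₀ := by
  have := FiniteDimensional.complete ℂ R
  obtain ⟨G, hGan, hG⟩ : ∃ G : ℂ → (H × R →L[ℂ] H × N), AnalyticAt ℂ G z₀ ∧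
      ∀ z x y, G z (x, y) = (W z x + ι y, P x) := by
    refine ⟨fun z => (ContinuousLinearMap.inl ℂ H N).comp
      ((W z).comp (ContinuousLinearMap.fst ℂ H R)) +
      (ι.comp (ContinuousLinearMap.snd ℂ H R)).prod (P.comp (ContinuousLinearMap.fst ℂ H R)),
      (analyticAt_clm_comp analyticAt_const (analyticAt_clm_comp hW analyticAt_const)).add
        analyticAt_const,
      fun z x y => ?_⟩
    simp
  have he' : (e : H × R →L[ℂ] H × N) = G z₀ := by
    refine ContinuousLinearMap.ext fun p => ?_
    rw [← Prod.mk.eta (p := p), hG]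
    exact he _ _
  let K : ℂ → (H × N →L[ℂ] H × R) := fun z => ContinuousLinearMap.inverse (G z)
  have hKan : AnalyticAt ℂ K z₀ := by
    have h1 : AnalyticAt ℂ (ContinuousLinearMap.inverse : (H × R →L[ℂ] H × N) → _) (G z₀) := by
      rw [← he']
      exact (contDiffAt_map_inverse (n := ⊤) e).analyticAt
    exact h1.comp hGan
  have hKinv : ∀ᶠ z in 𝓝 z₀, (∀ p, G z (K z p) = p) ∧ ∀ q, K z (G z q) = q := by
    have hopen : ∀ᶠ T in 𝓝 (G z₀), T.IsInvertible := by
      rw [← he']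
      exact ContinuousLinearEquiv.nhds e
    filter_upwards [hGan.continuousAt.eventually hopen] with z hz
    obtain ⟨f, hf⟩ := hz
    simp only [K, ← hf, ContinuousLinearMap.inverse_equiv]
    exact ⟨fun p => f.apply_symm_apply p, fun p => f.symm_apply_apply p⟩
  -- the blocks of the inverse of the bordered operator
  let K₁₁ : ℂ → (H →L[ℂ] H) := fun z =>
    (ContinuousLinearMap.fst ℂ H R).comp ((K z).comp (ContinuousLinearMap.inl ℂ H N))
  let K₁₂ : ℂ → (N →L[ℂ] H) := fun z =>
    (ContinuousLinearMap.fst ℂ H R).comp ((K z).comp (ContinuousLinearMap.inr ℂ H N))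
  let K₂₁ : ℂ → (H →L[ℂ] R) := fun z =>
    (ContinuousLinearMap.snd ℂ H R).comp ((K z).comp (ContinuousLinearMap.inl ℂ H N))
  let K₂₂ : ℂ → (N →L[ℂ] R) := fun z =>
    (ContinuousLinearMap.snd ℂ H R).comp ((K z).comp (ContinuousLinearMap.inr ℂ H N))
  have h₁₁ : AnalyticAt ℂ K₁₁ z₀ :=
    analyticAt_clm_comp analyticAt_const (analyticAt_clm_comp hKan analyticAt_const)
  have h₁₂ : AnalyticAt ℂ K₁₂ z₀ :=
    analyticAt_clm_comp analyticAt_const (analyticAt_clm_comp hKan analyticAt_const)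
  have h₂₁ : AnalyticAt ℂ K₂₁ z₀ :=
    analyticAt_clm_comp analyticAt_const (analyticAt_clm_comp hKan analyticAt_const)
  have h₂₂ : AnalyticAt ℂ K₂₂ z₀ :=
    analyticAt_clm_comp analyticAt_const (analyticAt_clm_comp hKan analyticAt_const)
  have hgood : ∀ᶠ z in 𝓝[≠] z₀, ∃ (V : H →L[ℂ] H) (T : R →L[ℂ] N),
      Ring.inverse (W z) = V ∧ (∀ n, T (K₂₂ z n) = n) ∧ (∀ y, K₂₂ z (T y) = y) ∧
      ∀ x, V x = K₁₁ z x - K₁₂ z (T (K₂₁ z x)) := by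
    filter_upwards [hinv, hKinv.filter_mono nhdsWithin_le_nhds] with z hz hK
    obtain ⟨u, hu⟩ := hz
    let V : H →L[ℂ] H := ((u⁻¹ : (H →L[ℂ] H)ˣ) : H →L[ℂ] H)
    have hVW : ∀ x, V (W z x) = x := fun x => by
      rw [← hu]; exact congrArg (fun T : H →L[ℂ] H => T x) u.inv_mul
    have hWV : ∀ x, W z (V x) = x := fun x => by
      rw [← hu]; exact congrArg (fun T : H →L[ℂ] H => T x) u.mul_inv
    have hinl : ∀ x, W z (K₁₁ z x) + ι (K₂₁ z x) = x ∧ P (K₁₁ z x) = 0 := fun x => by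
      have := hK.1 (x, 0)
      rw [← Prod.mk.eta (p := K z (x, 0)), hG] at this
      exact Prod.mk.inj this
    have hinr : ∀ n, W z (K₁₂ z n) + ι (K₂₂ z n) = 0 ∧ P (K₁₂ z n) = n := fun n => by
      have := hK.1 (0, n)
      rw [← Prod.mk.eta (p := K z (0, n)), hG] at this
      exact Prod.mk.inj this
    have hV12 : ∀ n, V (ι (K₂₂ z n)) = -K₁₂ z n := fun n => by
      rw [← hVW (K₁₂ z n), ← map_neg, eq_neg_of_add_eq_zero_right (hinr n).1]
    -- `W z` being invertible, the equation `G z (x, y) = (0, n)` is solved by `x = -V (ι y)`, which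
    -- identifies the inverse of the block `K₂₂ z`
    have hT : ∀ y, K₂₂ z (-P (V (ι y))) = y := fun y => by
      have := hK.2 (-V (ι y), y)
      rw [hG, map_neg, hWV, neg_add_cancel, map_neg] at this
      exact congrArg Prod.snd this
    refine ⟨V, -(P.comp (V.comp ι)), by rw [← hu, Ring.inverse_unit], fun n => ?_, hT, fun x => ?_⟩
    · simp [hV12, (hinr n).2]
    · conv_lhs => rw [← (hinl x).1]
      rw [map_add, hVW, sub_eq_add_neg, ← hV12]
      congr 3
      exact (hT _).symm
  -- as the block `K₂₂ z` is invertible at some point near `z₀`, `N` and `R` can be identified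
  obtain ⟨z, V, T, -, hT1, hT2, -⟩ := hgood.exists
  let J : R ≃L[ℂ] N := ContinuousLinearEquiv.equivOfInverse T (K₂₂ z) hT2 hT1
  let S : ℂ → (N →L[ℂ] N) := fun z => (J : R →L[ℂ] N).comp (K₂₂ z)
  have hS : AnalyticAt ℂ S z₀ := analyticAt_clm_comp analyticAt_const h₂₂
  have hSinv : ∀ᶠ z in 𝓝[≠] z₀, IsUnit (S z) ∧
      Ring.inverse (W z) =
        K₁₁ z - (K₁₂ z).comp ((Ring.inverse (S z)).comp ((J : R →L[ℂ] N).comp (K₂₁ z))) := by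
    filter_upwards [hgood] with z hz
    obtain ⟨V, T, hV, hT1, hT2, hVK⟩ := hz
    let u : (N →L[ℂ] N)ˣ :=
      ⟨S z, T.comp (J.symm : N →L[ℂ] R),
        ContinuousLinearMap.ext fun n => by simp [S, hT2],
        ContinuousLinearMap.ext fun n => by simp [S, hT1]⟩
    have hu : S z = u := rfl
    refine ⟨⟨u, rfl⟩, ?_⟩
    rw [hV, hu, Ring.inverse_unit]
    refine ContinuousLinearMap.ext fun x => ?_
    rw [hVK]
    simp [u]
  have hmer := meromorphicAt_inverse_of_finiteDimensional hS (hSinv.mono fun _ h => h.1)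
  refine MeromorphicAt.congr ?_ (hSinv.mono fun _ h => h.2.symm)
  obtain ⟨n, hn⟩ := hmer
  have hfac : AnalyticAt ℂ (fun z => (K₁₂ z).comp (((z - z₀) ^ n • Ring.inverse (S z)).comp
      ((J : R →L[ℂ] N).comp (K₂₁ z)))) z₀ :=
    analyticAt_clm_comp h₁₂ (analyticAt_clm_comp hn (analyticAt_clm_comp analyticAt_const h₂₁))
  refine h₁₁.meromorphicAt.sub ⟨n, hfac.congr (Eventually.of_forall fun z => ?_)⟩
  simp only [ContinuousLinearMap.smul_comp, ContinuousLinearMap.comp_smul]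

/-- The operator `W z₀` is bordered with a complement of its range and with a projection onto its
kernel. -/
theorem meromorphicAt_inverse_of_isEigenvalueOfFiniteType {W : ℂ → H →L[ℂ] H} {z₀ : ℂ}
    (hW : AnalyticAt ℂ W z₀) (h : IsEigenvalueOfFiniteType W z₀) :
    MeromorphicAt (fun z => Ring.inverse (W z)) z₀ := by
  have hinv : ∀ᶠ z in 𝓝[≠] z₀, IsUnit (W z) := by
    obtain ⟨δ, hδ, hi⟩ := h.invertible_near
    filter_upwards [self_mem_nhdsWithin, mem_nhdsWithin_of_mem_nhds (Metric.ball_mem_nhds z₀ hδ)]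
      with z hz hz' using hi z hz' hz
  obtain ⟨P, hP⟩ := h.fredholm.closedComplemented_ker
  obtain ⟨R, hR⟩ := Submodule.exists_isCompl (W z₀).range
  have : FiniteDimensional ℂ (W z₀).ker := h.fredholm.finite_ker
  have : FiniteDimensional ℂ R := .of_fg (h.fredholm.finite_coker.fg_of_isCompl hR)
  have := FiniteDimensional.complete ℂ R
  have := FiniteDimensional.complete ℂ (W z₀).ker
  let G : H × R →L[ℂ] H × (W z₀).ker :=
    ((W z₀).comp (ContinuousLinearMap.fst ℂ H R) +
      R.subtypeL.comp (ContinuousLinearMap.snd ℂ H R)).prod (P.comp (ContinuousLinearMap.fst ℂ H R))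
  have hG : ∀ x y, G (x, y) = (W z₀ x + R.subtypeL y, P x) := fun x y => rfl
  have hinj : Function.Injective G := by
    rw [injective_iff_map_eq_zero]
    rintro ⟨x, y⟩ hxy
    rw [hG, Prod.mk_eq_zero] at hxy
    have hy : (y : H) = 0 := by
      have hmem : (y : H) ∈ (W z₀).range := ⟨-x, by simpa using neg_eq_of_add_eq_zero_right hxy.1⟩
      have := hR.disjoint.le_bot ⟨hmem, y.2⟩
      simpa using this
    have hx : x ∈ (W z₀).ker := by simpa [hy] using hxy.1
    have := hP ⟨x, hx⟩
    simp only [hxy.2] at this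
    simp only [Prod.mk_eq_zero]
    exact ⟨by simpa using (congrArg Subtype.val this).symm, by simpa using hy⟩
  have hsurj : Function.Surjective G := by
    rintro ⟨h, n⟩
    obtain ⟨r, hr, y, hy, rfl⟩ := Submodule.mem_sup.1
      (show h ∈ (W z₀).range ⊔ R by rw [hR.sup_eq_top]; trivial)
    obtain ⟨x, rfl⟩ := hr
    refine ⟨(x + ((n - P x : (W z₀).ker) : H), ⟨y, hy⟩), ?_⟩
    rw [hG]
    have h0 : W z₀ ((n - P x : (W z₀).ker) : H) = 0 := (n - P x : (W z₀).ker).2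
    ext1
    · simp only [map_add, h0]
      simp
    · simp only [map_add, hP]
      simp
  exact meromorphicAt_inverse_of_bordered hW hinv R.subtypeL P
    (ContinuousLinearEquiv.ofBijective G (LinearMap.ker_eq_bot.2 hinj)
      (LinearMap.range_eq_top.2 hsurj)) fun x y => rfl

end Meromorphic

/-! ### The Laurent decomposition of the inverse -/

section Laurent

variable {H : Type*} [NormedAddCommGroup H] [InnerProductSpace ℂ H]

theorem finiteDimensional_range_of_mapsTo {c : H →L[ℂ] H} {S K : Submodule ℂ H} (hS : S.CoFG)
    [FiniteDimensional ℂ K] (hc : ∀ v ∈ S, c v ∈ K) : FiniteDimensional ℂ c.range := by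
  obtain ⟨T, hT⟩ := Submodule.exists_isCompl S
  have : FiniteDimensional ℂ T := .of_fg (hS.fg_of_isCompl hT)
  refine Submodule.finiteDimensional_of_le (S₂ := K ⊔ T.map (c : H →ₗ[ℂ] H)) ?_
  rintro _ ⟨x, rfl⟩
  obtain ⟨s, hs, t, ht, rfl⟩ := Submodule.mem_sup.1
    (show x ∈ S ⊔ T by rw [hT.sup_eq_top]; trivial)
  rw [map_add]
  exact Submodule.add_mem_sup (hc s hs) ⟨t, ht, rfl⟩

/-- If `W z (g z)` vanishes to order `d` at `z₀`, then the first `d` Taylor coefficients of `g` have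
finite rank. For the induction, the vanishing is only demanded on a subspace `S` of finite
codimension: there the constant coefficient maps into the kernel of `W z₀`, and it can be split off
after `S` has been cut down to its kernel. -/
theorem exists_taylor_of_finiteDimensional_ker {W : ℂ → H →L[ℂ] H} {z₀ : ℂ}
    (hW : ContinuousAt W z₀) [FiniteDimensional ℂ (W z₀).ker] (d : ℕ) :
    ∀ (S : Submodule ℂ H) (g : ℂ → H →L[ℂ] H), S.CoFG → AnalyticAt ℂ g z₀ →
      (∀ᶠ z in 𝓝[≠] z₀, ∀ v ∈ S, W z (g z v) = (z - z₀) ^ d • v) →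
      ∃ (c : ℕ → H →L[ℂ] H) (q : ℂ → H →L[ℂ] H), AnalyticAt ℂ q z₀ ∧
        (∀ z, g z = ∑ n ∈ Finset.range d, (z - z₀) ^ n • c n + (z - z₀) ^ d • q z) ∧
        (∀ n < d, FiniteDimensional ℂ (c n).range) ∧ (0 < d → c 0 = g z₀) := by
  induction d with
  | zero => exact fun S g _ hg _ => ⟨0, g, hg, by simp, by simp, by simp⟩
  | succ d ih =>
    intro S g hS hg hWg
    have hker : ∀ v ∈ S, g z₀ v ∈ (W z₀).ker := by
      intro v hv
      have h1 : Tendsto (fun z => W z (g z v)) (𝓝[≠] z₀) (𝓝 (W z₀ (g z₀ v))) :=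
        (hW.clm_apply (hg.continuousAt.clm_apply continuousAt_const)).tendsto.mono_left
          nhdsWithin_le_nhds
      have h2 : Tendsto (fun z => (z - z₀) ^ (d + 1) • v) (𝓝[≠] z₀) (𝓝 0) := by
        have : ContinuousAt (fun z => (z - z₀) ^ (d + 1) • v) z₀ := by fun_prop
        simpa using this.tendsto.mono_left nhdsWithin_le_nhds
      exact tendsto_nhds_unique h1 (h2.congr' (hWg.mono fun z hz => (hz v hv).symm))
    have hfin : FiniteDimensional ℂ (g z₀).range := finiteDimensional_range_of_mapsTo hS hker
    obtain ⟨p, hp⟩ := hg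
    have hg1 : AnalyticAt ℂ (dslope g z₀) z₀ := ⟨_, hp.has_fpower_series_dslope_fslope⟩
    have hS' : (S ⊓ (g z₀).ker).CoFG :=
      hS.inf (Submodule.range_fg_iff_ker_cofg.1 (Module.Finite.iff_fg.1 hfin))
    obtain ⟨c, q, hq, heq, hc, -⟩ := ih (S ⊓ (g z₀).ker) (dslope g z₀) hS' hg1 (by
      filter_upwards [hWg, self_mem_nhdsWithin] with z hz hne v hv
      have hne' : z - z₀ ≠ 0 := sub_ne_zero.2 hne
      have h1 : (z - z₀) • dslope g z₀ z v = g z v := by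
        have h0 : g z₀ v = 0 := hv.2
        rw [← smul_apply, sub_smul_dslope, sub_apply, h0,
          sub_zero]
      have h2 := hz v hv.1
      rw [← h1, map_smul, pow_succ', mul_smul] at h2
      exact smul_right_injective H hne' h2)
    refine ⟨fun n => n.casesOn (g z₀) c, q, hq, fun z => ?_, ?_, fun _ => rfl⟩
    · rw [Finset.sum_range_succ', ← sub_add_cancel (g z) (g z₀), ← sub_smul_dslope, heq z]
      simp only [pow_succ', mul_smul, smul_add, Finset.smul_sum, pow_zero, one_smul]
      abel
    · rintro (_ | n) hn
      · exact hfin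
      · exact hc n (by lia)

theorem eq_zero_of_hasSum_pow_smul {E : Type*} [NormedAddCommGroup E] [NormedSpace ℂ E] {b : ℕ → E}
    (h : ∀ᶠ z : ℂ in 𝓝 0, HasSum (fun n => z ^ n • b n) 0) (n : ℕ) : b n = 0 := by
  let p : FormalMultilinearSeries ℂ ℂ E := fun n =>
    ContinuousMultilinearMap.mkPiRing ℂ (Fin n) (b n)
  have hp : HasFPowerSeriesAt (0 : ℂ → E) p 0 := by
    rw [hasFPowerSeriesAt_iff]
    filter_upwards [h] with z hz
    simpa [p, FormalMultilinearSeries.coeff] using hz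
  have := congrArg (fun q : FormalMultilinearSeries ℂ ℂ E => q.coeff n) hp.eq_zero
  simpa [p, FormalMultilinearSeries.coeff] using this

variable [CompleteSpace H]

theorem exists_absConvOn_of_differentiableOn {f : ℂ → H →L[ℂ] H} {ρ : ℝ}
    (hf : DifferentiableOn ℂ f (Metric.ball 0 ρ)) :
    ∃ B : ℕ → H →L[ℂ] H, AbsConvOn B ρ ∧
      ∀ z ∈ Metric.ball (0 : ℂ) ρ, HasSum (fun n => z ^ n • B n) (f z) := by
  have hsum : ∀ z ∈ Metric.ball (0 : ℂ) ρ,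
      HasSum (fun n => z ^ n • ((n.factorial : ℂ)⁻¹ • iteratedDeriv n f 0)) (f z) := by
    intro z hz
    refine (Complex.hasSum_taylorSeries_on_ball hf hz).congr_fun fun n => ?_
    rw [sub_zero, smul_comm]
  refine ⟨_, fun z hz => ?_, hsum⟩
  -- the terms are bounded at a radius `s` between `‖z‖` and `ρ`
  obtain ⟨s, hzs, hsρ⟩ := exists_between (mem_ball_zero_iff.1 hz)
  have hs0 : 0 < s := (norm_nonneg z).trans_lt hzs
  have hs := (hsum (s : ℂ) (by simpa [abs_of_pos hs0] using hsρ)).summable.tendsto_atTop_zero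
  obtain ⟨M, hM⟩ := (hs.norm.bddAbove_range)
  refine Summable.of_nonneg_of_le (fun n => by positivity) (fun n => ?_)
    ((summable_geometric_of_lt_one (r := ‖z‖ / s) (by positivity)
      ((div_lt_one hs0).2 hzs)).mul_left M)
  have h1 := hM ⟨n, rfl⟩
  simp only [norm_smul, norm_pow, Complex.norm_real, Real.norm_of_nonneg hs0.le] at h1 ⊢
  calc _ = (s ^ n * (‖(n.factorial : ℂ)⁻¹‖ * ‖iteratedDeriv n f 0‖)) * (‖z‖ / s) ^ n := by
        rw [div_pow]; field_simp
    _ ≤ _ := by gcongr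

theorem analyticAt_arPoly {k : ℕ} (a : Fin k → H →L[ℂ] H) (z : ℂ) :
    AnalyticAt ℂ (arPoly a) z := by
  refine analyticAt_const.sub (Finset.analyticAt_fun_sum _ fun h _ => ?_)
  exact (analyticAt_id.pow _).smul analyticAt_const

theorem analyticAt_inverse_arPoly {k : ℕ} {a : Fin k → H →L[ℂ] H} {z : ℂ}
    (h : IsUnit (arPoly a z)) : AnalyticAt ℂ (fun z => Ring.inverse (arPoly a z)) z := by
  obtain ⟨u, hu⟩ := h
  have := analyticAt_inverse (𝕜 := ℂ) u
  rw [hu] at this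
  exact this.comp (analyticAt_arPoly a z)

/-- The inverse has a pole at `1`, since a finite limit there would be an inverse of `arPoly a 1`,
which is not injective. -/
theorem exists_meromorphicOrderAt_inverse_arPoly {k : ℕ} {a : Fin k → H →L[ℂ] H} {ρ : ℝ}
    (ha : IsUnitRootOfFiniteType a ρ) :
    ∃ d : ℕ, 1 ≤ d ∧
      meromorphicOrderAt (fun z => Ring.inverse (arPoly a z)) 1 = ((-(d : ℤ) : ℤ) : WithTop ℤ) := by
  have hmer := meromorphicAt_inverse_of_isEigenvalueOfFiniteType (analyticAt_arPoly a 1)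
    ha.eigenvalue
  have hneg : meromorphicOrderAt (fun z => Ring.inverse (arPoly a z)) 1 < 0 := by
    by_contra! hnonneg
    obtain ⟨T, hT⟩ := tendsto_nhds_of_meromorphicOrderAt_nonneg hmer hnonneg
    have h1 : Tendsto (fun z => Ring.inverse (arPoly a z) * arPoly a z) (𝓝[≠] 1)
        (𝓝 (T * arPoly a 1)) :=
      hT.mul ((analyticAt_arPoly a 1).continuousAt.tendsto.mono_left nhdsWithin_le_nhds)
    have h2 : Tendsto (fun z => Ring.inverse (arPoly a z) * arPoly a z) (𝓝[≠] 1) (𝓝 1) := by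
      refine tendsto_const_nhds.congr' ?_
      obtain ⟨δ, hδ, hi⟩ := ha.eigenvalue.invertible_near
      filter_upwards [self_mem_nhdsWithin, mem_nhdsWithin_of_mem_nhds (Metric.ball_mem_nhds 1 hδ)]
        with z hz hz'
      exact (Ring.inverse_mul_cancel _ (hi z hz' hz)).symm
    obtain ⟨v, hv, hv0⟩ := ha.eigenvalue.exists_ker
    have := congrArg (fun T : H →L[ℂ] H => T v) (tendsto_nhds_unique h1 h2)
    exact hv (by simpa [hv0] using this.symm)
  obtain ⟨m, hm⟩ := WithTop.ne_top_iff_exists.1 (ne_top_of_lt hneg)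
  rw [← hm] at hneg ⊢
  have hm0 : m < 0 := by exact_mod_cast hneg
  exact ⟨m.natAbs, by lia, by congr 1; lia⟩

theorem exists_laurent_inverse_arPoly {k : ℕ} {a : Fin k → H →L[ℂ] H} {ρ : ℝ}
    (ha : IsUnitRootOfFiniteType a ρ) :
    ∃ (d : ℕ) (C Cstar : ℕ → H →L[ℂ] H), 1 ≤ d ∧
      meromorphicOrderAt (fun z => Ring.inverse (arPoly a z)) 1 = ((-(d : ℤ) : ℤ) : WithTop ℤ) ∧
      C 0 ≠ 0 ∧ (∀ n < d, FiniteDimensional ℂ (C n).range) ∧ AbsConvOn Cstar ρ ∧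
      ∀ z ∈ Metric.ball (0 : ℂ) ρ, z ≠ 1 →
        Ring.inverse (arPoly a z) =
          ∑ n ∈ Finset.range d, ((1 - z) ^ (d - n))⁻¹ • C n + ∑' n : ℕ, z ^ n • Cstar n := by
  have hmer := meromorphicAt_inverse_of_isEigenvalueOfFiniteType (analyticAt_arPoly a 1)
    ha.eigenvalue
  have : FiniteDimensional ℂ (arPoly a 1).ker := ha.eigenvalue.fredholm.finite_ker
  have hball : ∀ᶠ z in 𝓝[≠] (1 : ℂ), z ∈ Metric.ball (0 : ℂ) ρ :=
    nhdsWithin_le_nhds (Metric.isOpen_ball.mem_nhds (by simpa using ha.one_lt))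
  obtain ⟨d, hd, hord⟩ := exists_meromorphicOrderAt_inverse_arPoly ha
  obtain ⟨g, hg, hg0, hgeq⟩ := (meromorphicOrderAt_eq_int_iff hmer).1 hord
  obtain ⟨c, q, hq, hgc, hc, hc0⟩ := exists_taylor_of_finiteDimensional_ker
    (analyticAt_arPoly a 1).continuousAt d ⊤ g .top hg (by
      filter_upwards [hgeq, hball, self_mem_nhdsWithin] with z hz hzρ hz1 v _
      have h1 : arPoly a z * Ring.inverse (arPoly a z) = 1 :=
        Ring.mul_inverse_cancel _ (ha.invertible z hzρ hz1)
      have h2 : (z - 1) ^ d • Ring.inverse (arPoly a z) = g z := by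
        rw [hz, smul_smul, zpow_neg, zpow_natCast,
          mul_inv_cancel₀ (pow_ne_zero _ (sub_ne_zero.2 hz1)), one_smul]
      have h3 : arPoly a z * g z = (z - 1) ^ d • 1 := by rw [← h2, mul_smul_comm, h1]
      simpa using congrArg (fun T : H →L[ℂ] H => T v) h3)
  let C : ℕ → H →L[ℂ] H := fun n => (-1 : ℂ) ^ (d - n) • c n
  let F : ℂ → H →L[ℂ] H := fun z =>
    Ring.inverse (arPoly a z) - ∑ n ∈ Finset.range d, ((1 - z) ^ (d - n))⁻¹ • C n
  have hFq : ∀ᶠ z in 𝓝[≠] (1 : ℂ), F z = q z := by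
    filter_upwards [hgeq, self_mem_nhdsWithin] with z hz hz1
    have hz1' : z - 1 ≠ 0 := sub_ne_zero.2 hz1
    simp only [F, hz, hgc, smul_add, Finset.smul_sum, smul_smul]
    rw [zpow_neg, zpow_natCast, inv_mul_cancel₀ (pow_ne_zero _ hz1'), one_smul, add_sub_right_comm,
      ← Finset.sum_sub_distrib, Finset.sum_eq_zero, zero_add]
    intro n hn
    rw [Finset.mem_range] at hn
    rw [sub_eq_zero, smul_smul]
    congr 1
    obtain ⟨m, rfl⟩ := Nat.exists_eq_add_of_lt hn
    rw [show n + m + 1 - n = m + 1 by lia, show (1 - z) = -1 * (z - 1) by ring, mul_pow, mul_inv,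
      show n + m + 1 = m + 1 + n by lia, pow_add _ (m + 1) n, mul_inv]
    have h1 : ((-1 : ℂ) ^ (m + 1))⁻¹ * (-1) ^ (m + 1) = 1 := inv_mul_cancel₀ (by simp)
    have h2 : ((z - 1) ^ n)⁻¹ * (z - 1) ^ n = 1 := inv_mul_cancel₀ (pow_ne_zero _ hz1')
    linear_combination ((z - 1) ^ (m + 1))⁻¹ * h2 - ((z - 1) ^ (m + 1))⁻¹ * h1
  have hF1 : Function.update F 1 (q 1) =ᶠ[𝓝 1] q := by
    rw [← nhdsNE_sup_pure, EventuallyEq, eventually_sup]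
    refine ⟨?_, by simp⟩
    filter_upwards [hFq, self_mem_nhdsWithin] with z hz hz1
    rwa [Function.update_of_ne hz1]
  have hdiff : DifferentiableOn ℂ (Function.update F 1 (q 1)) (Metric.ball 0 ρ) := by
    intro z hz
    refine DifferentiableAt.differentiableWithinAt ?_
    by_cases hz1 : z = 1
    · subst hz1
      exact (hq.differentiableAt).congr_of_eventuallyEq hF1
    · have hFz : DifferentiableAt ℂ F z := by
        refine (analyticAt_inverse_arPoly (ha.invertible z hz hz1)).differentiableAt.sub ?_
        refine DifferentiableAt.fun_sum fun n _ => DifferentiableAt.smul_const ?_ _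
        exact DifferentiableAt.inv (by fun_prop) (pow_ne_zero _ (sub_ne_zero.2 (Ne.symm hz1)))
      refine hFz.congr_of_eventuallyEq ?_
      filter_upwards [isOpen_ne.mem_nhds hz1] with w hw
      exact Function.update_of_ne hw _ _
  obtain ⟨Cstar, hCstar, hsum⟩ := exists_absConvOn_of_differentiableOn hdiff
  refine ⟨d, C, Cstar, hd, hord, ?_, fun n hn => ?_, hCstar, fun z hz hz1 => ?_⟩
  · simpa [C, hc0 hd] using hg0
  · have := hc n hn
    refine Submodule.finiteDimensional_of_le (S₂ := (c n).range) ?_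
    rintro _ ⟨x, rfl⟩
    exact Submodule.smul_mem _ _ ⟨x, rfl⟩
  · rw [(hsum z hz).tsum_eq, Function.update_of_ne hz1, add_sub_cancel]

end Laurent

/-! ### Differences and cumulations -/

section Lags

variable {V V' : Type*} [AddCommGroup V] [AddCommGroup V']

theorem diffOp_iterate_map (f : V →+ V') (w : ℤ → V) (n : ℕ) :
    diffOp^[n] (fun t => f (w t)) = fun t => f (diffOp^[n] w t) := by
  induction n with
  | zero => rfl
  | succ n ih =>
    rw [Function.iterate_succ_apply', Function.iterate_succ_apply', ih]
    funext t
    simp [diffOp]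

theorem diffOp_iterate_sub (v w : ℤ → V) (n : ℕ) :
    diffOp^[n] (fun t => v t - w t) = fun t => diffOp^[n] v t - diffOp^[n] w t := by
  induction n with
  | zero => rfl
  | succ n ih =>
    simp only [Function.iterate_succ_apply', ih]
    funext t
    simp only [diffOp]
    abel

theorem diffOp_iterate_sum {ι : Type*} (s : Finset ι) (w : ι → ℤ → V) (n : ℕ) :
    diffOp^[n] (fun t => ∑ i ∈ s, w i t) = fun t => ∑ i ∈ s, diffOp^[n] (w i) t := by
  induction n with
  | zero => rfl
  | succ n ih =>
    simp only [Function.iterate_succ_apply', ih]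
    funext t
    simp only [diffOp, Finset.sum_sub_distrib]

theorem diffOp_iterate_of_neg {w : ℤ → V} (hw : ∀ t < 0, w t = 0) (n : ℕ) :
    ∀ t < 0, diffOp^[n] w t = 0 := by
  induction n with
  | zero => exact hw
  | succ n ih =>
    intro t ht
    rw [Function.iterate_succ_apply', diffOp, ih t ht, ih (t - 1) (by lia), sub_zero]

theorem diffOp_cumOp (w : ℤ → V) : diffOp (cumOp w) = w := by
  funext t
  simp only [diffOp, cumOp]
  rcases lt_trichotomy t 0 with ht | rfl | ht
  · rw [if_neg (by lia), if_pos (by lia), if_neg (by lia), if_pos (by lia), sub_add_cancel,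
      ← Finset.insert_Icc_add_one_left_eq_Icc (show t ≤ 0 by lia), Finset.sum_insert (by simp)]
    abel
  · simp
  · rw [if_pos (by lia)]
    have : Finset.Icc 1 t = insert t (Finset.Icc 1 (t - 1)) :=
      (Finset.insert_Icc_sub_one_right_eq_Icc (show 1 ≤ t by lia)).symm
    rw [this, Finset.sum_insert (by simp)]
    split_ifs with h1 h2
    · abel
    · lia
    · rw [Finset.Icc_eq_empty (by lia)]
      simp

theorem diffOp_iterate_commonTrend (w : ℤ → V) {d n : ℕ} (hn : n ≤ d) :
    diffOp^[d] (commonTrend w (d - n)) = diffOp^[n] w := by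
  obtain ⟨m, rfl⟩ := Nat.exists_eq_add_of_le hn
  rw [Nat.add_sub_cancel_left, Function.iterate_add_apply, commonTrend,
    Function.LeftInverse.iterate diffOp_cumOp m]

theorem cumOp_map (f : V →+ V') (w : ℤ → V) :
    cumOp (fun t => f (w t)) = fun t => f (cumOp w t) := by
  funext t
  simp only [cumOp]
  split_ifs <;> simp

theorem commonTrend_map (f : V →+ V') (w : ℤ → V) (h : ℕ) (t : ℤ) :
    commonTrend (fun t => f (w t)) h t = f (commonTrend w h t) := by
  have : commonTrend (fun t => f (w t)) h = fun t => f (commonTrend w h t) := by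
    unfold commonTrend
    induction h with
    | zero => rfl
    | succ h ih => rw [Function.iterate_succ_apply', Function.iterate_succ_apply', ih, cumOp_map]
  rw [this]

theorem commonTrend_congr {v w : ℤ → V} {m : ℤ} (hvw : ∀ t, m ≤ t → t ≤ 0 → v t = w t) (h : ℕ) :
    ∀ t, m ≤ t → t ≤ 0 → commonTrend v h t = commonTrend w h t := by
  unfold commonTrend
  induction h with
  | zero => exact hvw
  | succ h ih =>
    intro t hmt ht
    rw [Function.iterate_succ_apply', Function.iterate_succ_apply', cumOp, cumOp,
      if_neg (show ¬1 ≤ t by lia), if_neg (show ¬1 ≤ t by lia)]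
    refine if_congr Iff.rfl (congrArg _ (Finset.sum_congr rfl fun i hi => ?_)) rfl
    rw [Finset.mem_Icc] at hi
    exact ih i (by lia) hi.2

theorem eq_zero_of_diffOp_iterate_eq_zero {d : ℕ} :
    ∀ {w : ℤ → V}, diffOp^[d] w = 0 → (∀ j < d, w (-(j : ℤ)) = 0) → w = 0 := by
  induction d with
  | zero => exact fun h _ => h
  | succ d ih =>
    intro w hw h0
    have hd : diffOp w = 0 := ih hw fun j hj => by
      rw [diffOp, h0 j (by lia), show -(j : ℤ) - 1 = -((j + 1 : ℕ) : ℤ) by push_cast; ring,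
        h0 (j + 1) (by lia), sub_zero]
    have hstep : ∀ t, w t = w (t - 1) := fun t => sub_eq_zero.1 (congrFun hd t)
    have h00 : w 0 = 0 := by simpa using h0 0 (by lia)
    funext t
    induction t with
    | zero => exact h00
    | succ t ht => rw [hstep, add_sub_cancel_right, ht]; rfl
    | pred t ht => rw [← hstep, ht]; rfl

variable {E : Type*} [AddCommGroup E] [Module ℂ E]

theorem diffOp_iterate_eval {p : Polynomial ℂ} {d : ℕ} (hp : p.natDegree < d) :
    diffOp^[d] (fun t : ℤ => p.eval (t : ℂ)) = 0 := by
  have key : ∀ (n : ℕ) (t : ℤ), diffOp^[n] (fun t : ℤ => p.eval (t : ℂ)) t =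
      (fwdDiff 1)^[n] p.eval ((t : ℂ) - n) := by
    intro n
    induction n with
    | zero => intro t; simp
    | succ n ih =>
      intro t
      rw [Function.iterate_succ_apply', Function.iterate_succ_apply', diffOp, ih, ih, fwdDiff,
        show (t : ℂ) - ((n + 1 : ℕ) : ℂ) + 1 = t - n by push_cast; ring,
        show ((t - 1 : ℤ) : ℂ) - n = t - ((n + 1 : ℕ) : ℂ) by push_cast; ring]
  funext t
  rw [key, Polynomial.fwdDiff_iter_eq_zero_of_degree_lt hp]
  rfl

/-- Lagrange polynomials with the nodes `0, -1, …, -(d - 1)`. -/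
noncomputable def lagrangePoly (d j : ℕ) : Polynomial ℂ :=
  Lagrange.basis (Finset.range d) (fun i => -(i : ℂ)) j

theorem natDegree_lagrangePoly_lt {d j : ℕ} (hj : j < d) : (lagrangePoly d j).natDegree < d := by
  have hinj : Set.InjOn (fun i : ℕ => -(i : ℂ)) (Finset.range d) := fun i _ j _ h => by
    simpa using h
  have := Lagrange.degree_basis hinj (Finset.mem_range.2 hj)
  rw [lagrangePoly, Polynomial.natDegree_eq_of_degree_eq_some this, Finset.card_range]
  lia

/-- A sequence with vanishing `d`-th difference is the polynomial that interpolates it at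
`0, -1, …, -(d - 1)`. -/
theorem eq_sum_pow_smul_of_diffOp_iterate_eq_zero {d : ℕ} {w : ℤ → E} (hw : diffOp^[d] w = 0)
    (t : ℤ) : w t = ∑ n ∈ Finset.range d, (t : ℂ) ^ n •
      ∑ j ∈ Finset.range d, (lagrangePoly d j).coeff n • w (-(j : ℤ)) := by
  have hinj : Set.InjOn (fun i : ℕ => -(i : ℂ)) (Finset.range d) := fun i _ j _ h => by
    simpa using h
  have h1 : (fun t => w t - ∑ j ∈ Finset.range d, (lagrangePoly d j).eval (t : ℂ) • w (-(j : ℤ)))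
      = 0 := by
    refine eq_zero_of_diffOp_iterate_eq_zero (d := d) ?_ fun i hi => ?_
    · rw [diffOp_iterate_sub, hw, diffOp_iterate_sum]
      funext t
      simp only [Pi.zero_apply, zero_sub, neg_eq_zero]
      refine Finset.sum_eq_zero fun j hj => ?_
      have := diffOp_iterate_map ((LinearMap.toSpanSingleton ℂ E (w (-(j : ℤ)))).toAddMonoidHom)
        (fun t : ℤ => (lagrangePoly d j).eval (t : ℂ)) d
      rw [diffOp_iterate_eval (natDegree_lagrangePoly_lt (Finset.mem_range.1 hj))] at this
      simpa using congrFun this t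
    · rw [sub_eq_zero, Finset.sum_eq_single i]
      · have := Lagrange.eval_basis_self hinj (Finset.mem_range.2 hi)
        simp only [lagrangePoly]
        push_cast
        rw [this, one_smul]
      · intro j hj hji
        have := Lagrange.eval_basis_of_ne (v := fun i : ℕ => -(i : ℂ)) hji (Finset.mem_range.2 hi)
        simp only [lagrangePoly]
        push_cast
        rw [this, zero_smul]
      · exact fun h => absurd (Finset.mem_range.2 hi) h
  rw [sub_eq_zero.1 (congrFun h1 t)]
  simp only [Finset.smul_sum, smul_smul]
  rw [Finset.sum_comm]
  refine Finset.sum_congr rfl fun j hj => ?_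
  rw [Polynomial.eval_eq_sum_range' (natDegree_lagrangePoly_lt (Finset.mem_range.1 hj)),
    Finset.sum_smul]
  exact Finset.sum_congr rfl fun n _ => by rw [mul_comm]

end Lags

/-! ### Generating functions and lag polynomials -/

section Generating

theorem hasSum_of_shift {E : Type*} [AddCommGroup E] [TopologicalSpace E] [IsTopologicalAddGroup E]
    {f g : ℕ → E} {s : E} (hf : HasSum f s) (h0 : g 0 = 0) (hg : ∀ n, g (n + 1) = f n) :
    HasSum g s := by
  rw [← hasSum_nat_add_iff' 1]
  simpa [h0, hg] using hf

theorem hasSum_pow_smul_sub {E : Type*} [NormedAddCommGroup E] [NormedSpace ℂ E] {b : ℤ → E}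
    (hb : ∀ j < 0, b j = 0) {z : ℂ} {s : E} (h : HasSum (fun n : ℕ => z ^ n • b n) s) (m : ℕ) :
    HasSum (fun n : ℕ => z ^ n • b ((n : ℤ) - m)) (z ^ m • s) := by
  induction m with
  | zero => simpa using h
  | succ m ih =>
    have := ih.const_smul z
    rw [smul_smul, ← pow_succ'] at this
    refine hasSum_of_shift this ?_ fun n => ?_
    · rw [hb _ (by push_cast; lia), smul_zero]
    · rw [smul_smul, ← pow_succ']
      congr 2
      push_cast
      ring

/-- The operator `1 - L` on coefficients multiplies the generating function by `1 - z`. -/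
theorem hasSum_pow_smul_diffOp_iterate {E : Type*} [NormedAddCommGroup E] [NormedSpace ℂ E]
    {b : ℤ → E} (hb : ∀ j < 0, b j = 0) {z : ℂ} {s : E}
    (h : HasSum (fun n : ℕ => z ^ n • b n) s) (m : ℕ) :
    HasSum (fun n : ℕ => z ^ n • diffOp^[m] b n) ((1 - z) ^ m • s) := by
  induction m with
  | zero => simpa using h
  | succ m ih =>
    have h1 := hasSum_pow_smul_sub (diffOp_iterate_of_neg hb m) ih 1
    have h2 := ih.sub h1
    rw [← smul_assoc, ← sub_smul, smul_eq_mul, pow_one,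
      show (1 - z) ^ m - z * (1 - z) ^ m = (1 - z) ^ (m + 1) by ring] at h2
    refine h2.congr_fun fun n => ?_
    rw [Function.iterate_succ_apply', diffOp, smul_sub]
    norm_cast

variable {H : Type*} [NormedAddCommGroup H] [InnerProductSpace ℂ H]

/-- The operator `1 - L` on coefficients amounts to differencing the filtered sequence. -/
theorem hasSum_diffOp_iterate_apply {b : ℤ → H →L[ℂ] H} (hb : ∀ j < 0, b j = 0) {w u : ℤ → H}
    (h : ∀ t, HasSum (fun n : ℕ => b n (w (t - n))) (u t)) (m : ℕ) :
    ∀ t, HasSum (fun n : ℕ => diffOp^[m] b n (w (t - n))) (diffOp^[m] u t) := by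
  induction m with
  | zero => exact h
  | succ m ih =>
    intro t
    have h1 : HasSum (fun n : ℕ => diffOp^[m] b ((n : ℤ) - 1) (w (t - n)))
        (diffOp^[m] u (t - 1)) := by
      refine hasSum_of_shift (ih (t - 1)) ?_ fun n => ?_
      · rw [diffOp_iterate_of_neg hb m _ (by simp)]
        rfl
      · push_cast
        rw [add_sub_cancel_right, sub_sub, add_comm (n : ℤ)]
    rw [Function.iterate_succ_apply', Function.iterate_succ_apply']
    exact ((ih t).sub h1)

/-- The sequence with the single coefficient `c` at `0`. -/
noncomputable def constCoeff (c : H →L[ℂ] H) : ℤ → H →L[ℂ] H :=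
  fun j => if j = 0 then c else 0

/-- The coefficients of a power series, extended by zero to negative indices. -/
noncomputable def extCoeff (B : ℕ → H →L[ℂ] H) : ℤ → H →L[ℂ] H :=
  fun j => if 0 ≤ j then B j.toNat else 0

theorem constCoeff_of_neg (c : H →L[ℂ] H) : ∀ j < 0, constCoeff c j = 0 := fun _ hj =>
  if_neg hj.ne

theorem extCoeff_of_neg (B : ℕ → H →L[ℂ] H) : ∀ j < 0, extCoeff B j = 0 := fun _ hj =>
  if_neg (not_le.2 hj)

@[simp]
theorem extCoeff_natCast (B : ℕ → H →L[ℂ] H) (n : ℕ) : extCoeff B n = B n := by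
  simp [extCoeff]

theorem hasSum_pow_smul_constCoeff (c : H →L[ℂ] H) (z : ℂ) :
    HasSum (fun n : ℕ => z ^ n • constCoeff c n) c := by
  have := hasSum_single (f := fun n : ℕ => z ^ n • constCoeff c n) 0 fun n hn => by
    simp [constCoeff, hn]
  simpa [constCoeff] using this

theorem hasSum_constCoeff_apply (c : H →L[ℂ] H) (w : ℤ → H) (t : ℤ) :
    HasSum (fun n : ℕ => constCoeff c n (w (t - n))) (c (w t)) := by
  have := hasSum_single (f := fun n : ℕ => constCoeff c n (w (t - n))) 0 fun n hn => by
    simp [constCoeff, hn]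
  simpa [constCoeff] using this

/-- The coefficients of `(1 - z)^d A(z)⁻¹ = ∑_{n < d} (1 - z)^n C_n + (1 - z)^d C⋆(z)`. -/
noncomputable def clearedCoeff (d : ℕ) (C Cstar : ℕ → H →L[ℂ] H) : ℤ → H →L[ℂ] H :=
  fun j => ∑ n ∈ Finset.range d, diffOp^[n] (constCoeff (C n)) j + diffOp^[d] (extCoeff Cstar) j

theorem clearedCoeff_of_neg (d : ℕ) (C Cstar : ℕ → H →L[ℂ] H) :
    ∀ j < 0, clearedCoeff d C Cstar j = 0 := by
  intro j hj
  rw [clearedCoeff, diffOp_iterate_of_neg (extCoeff_of_neg Cstar) d j hj, add_zero]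
  exact Finset.sum_eq_zero fun n _ => diffOp_iterate_of_neg (constCoeff_of_neg (C n)) n j hj

theorem hasSum_pow_smul_clearedCoeff (d : ℕ) (C : ℕ → H →L[ℂ] H) {Cstar : ℕ → H →L[ℂ] H}
    {z : ℂ} {s : H →L[ℂ] H} (h : HasSum (fun n => z ^ n • Cstar n) s) :
    HasSum (fun n : ℕ => z ^ n • clearedCoeff d C Cstar n)
      (∑ n ∈ Finset.range d, (1 - z) ^ n • C n + (1 - z) ^ d • s) := by
  have h1 := hasSum_pow_smul_diffOp_iterate (extCoeff_of_neg Cstar) (z := z) (s := s)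
    (by simpa using h) d
  have h2 := hasSum_sum (s := Finset.range d) fun n _ =>
    hasSum_pow_smul_diffOp_iterate (constCoeff_of_neg (C n)) (hasSum_pow_smul_constCoeff (C n) z) n
  refine (h2.add h1).congr_fun fun n => ?_
  rw [clearedCoeff, smul_add, Finset.smul_sum]

theorem hasSum_clearedCoeff_apply (d : ℕ) (C : ℕ → H →L[ℂ] H) {Cstar : ℕ → H →L[ℂ] H}
    {w y : ℤ → H} (h : ∀ t, HasSum (fun n : ℕ => Cstar n (w (t - n))) (y t)) (t : ℤ) :
    HasSum (fun n : ℕ => clearedCoeff d C Cstar n (w (t - n)))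
      (∑ n ∈ Finset.range d, C n (diffOp^[n] w t) + diffOp^[d] y t) := by
  have h1 := hasSum_diffOp_iterate_apply (extCoeff_of_neg Cstar) (w := w) (u := y)
    (by simpa using h) d t
  have h2 := hasSum_sum (s := Finset.range d) fun n _ =>
    hasSum_diffOp_iterate_apply (constCoeff_of_neg (C n)) (hasSum_constCoeff_apply (C n) w) n t
  have h3 : ∀ n, diffOp^[n] (fun t => C n (w t)) t = C n (diffOp^[n] w t) := fun n =>
    congrFun (diffOp_iterate_map ((C n : H →ₗ[ℂ] H).toAddMonoidHom) w n) t
  simp only [h3] at h2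
  refine (h2.add h1).congr_fun fun n => ?_
  simp [clearedCoeff]

variable {k : ℕ} {a : Fin k → H →L[ℂ] H} {ρ : ℝ} {d : ℕ} {C Cstar : ℕ → H →L[ℂ] H}

theorem summable_pow_smul_of_absConvOn [CompleteSpace H] {B : ℕ → H →L[ℂ] H} (hB : AbsConvOn B ρ)
    {z : ℂ} (hz : z ∈ Metric.ball (0 : ℂ) ρ) : Summable fun n => z ^ n • B n := by
  refine Summable.of_norm ?_
  simpa [norm_smul, mul_comm] using hB z hz

/-- The coefficient identity expressing `(1 - z)^d A(z)⁻¹ A(z) = (1 - z)^d`. -/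
theorem clearedCoeff_sub_sum [CompleteSpace H] (ha : IsUnitRootOfFiniteType a ρ)
    (hC : AbsConvOn Cstar ρ)
    (hinv : ∀ z ∈ Metric.ball (0 : ℂ) ρ, z ≠ 1 →
        Ring.inverse (arPoly a z) =
          ∑ n ∈ Finset.range d, ((1 - z) ^ (d - n))⁻¹ • C n + ∑' n : ℕ, z ^ n • Cstar n)
    (j : ℕ) :
    clearedCoeff d C Cstar j - ∑ h : Fin k, clearedCoeff d C Cstar ((j : ℤ) - ((h : ℕ) + 1)) * a h =
      diffOp^[d] (constCoeff 1) j := by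
  rw [← sub_eq_zero]
  refine eq_zero_of_hasSum_pow_smul (b := fun j : ℕ => clearedCoeff d C Cstar j -
    ∑ h : Fin k, clearedCoeff d C Cstar ((j : ℤ) - ((h : ℕ) + 1)) * a h -
      diffOp^[d] (constCoeff 1) j) ?_ j
  have hnear : ∀ᶠ z : ℂ in 𝓝 0, z ∈ Metric.ball (0 : ℂ) 1 := Metric.ball_mem_nhds 0 one_pos
  filter_upwards [hnear] with z hz
  have hz1 : z ≠ 1 := by rintro rfl; simp at hz
  have hzρ : z ∈ Metric.ball (0 : ℂ) ρ := Metric.ball_subset_ball ha.one_lt.le hz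
  have hD := hasSum_pow_smul_clearedCoeff d C (summable_pow_smul_of_absConvOn hC hzρ).hasSum
  have hs : ∑ n ∈ Finset.range d, (1 - z) ^ n • C n + (1 - z) ^ d • ∑' n, z ^ n • Cstar n =
      (1 - z) ^ d • Ring.inverse (arPoly a z) := by
    rw [hinv z hzρ hz1, smul_add, Finset.smul_sum]
    congr 1
    refine Finset.sum_congr rfl fun n hn => ?_
    rw [smul_smul, ← Nat.sub_add_cancel (Finset.mem_range.1 hn).le, pow_add, Nat.add_sub_cancel,
      mul_right_comm, mul_inv_cancel₀ (pow_ne_zero _ (sub_ne_zero.2 hz1.symm)), one_mul]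
  rw [hs] at hD
  set T := (1 - z) ^ d • Ring.inverse (arPoly a z) with hT
  have h2 := hasSum_sum (s := Finset.univ) fun (h : Fin k) _ =>
    (hasSum_pow_smul_sub (clearedCoeff_of_neg d C Cstar) hD (h + 1)).mul_right (a h)
  have h3 := hasSum_pow_smul_diffOp_iterate (constCoeff_of_neg (1 : H →L[ℂ] H))
    (hasSum_pow_smul_constCoeff 1 z) d
  have h4 : T - ∑ h : Fin k, z ^ ((h : ℕ) + 1) • T * a h - (1 - z) ^ d • 1 = 0 := by
    have : T * arPoly a z = (1 - z) ^ d • 1 := by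
      rw [hT, smul_mul_assoc, Ring.inverse_mul_cancel _ (ha.invertible z hzρ hz1)]
    rw [sub_eq_zero, ← this, arPoly, mul_sub, mul_one, Finset.mul_sum]
    simp only [smul_mul_assoc, mul_smul_comm]
  rw [← h4]
  refine ((hD.sub h2).sub h3).congr_fun fun n => ?_
  simp only [smul_sub, Finset.smul_sum, smul_mul_assoc]
  push_cast
  rfl

end Generating

/-! ### Inverting the autoregression along a path -/

section Path

variable {H : Type*} [NormedAddCommGroup H] [InnerProductSpace ℂ H]

/-- The boundary terms left over when the autoregression is filtered with `D_0, …, D_{N-1}`. -/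
noncomputable def boundaryTerm {k : ℕ} (a : Fin k → H →L[ℂ] H) (D : ℤ → H →L[ℂ] H) (x : ℤ → H)
    (t : ℤ) (N : ℕ) : H :=
  ∑ h : Fin k, ∑ i ∈ Finset.range ((h : ℕ) + 1),
    D ((N + i : ℕ) - ((h : ℕ) + 1)) (a h (x (t - (N + i : ℕ))))

/-- Summation by parts: the lags of the autoregression are shifted onto the coefficients. -/
theorem sum_apply_eq_sub_boundaryTerm {k : ℕ} {a : Fin k → H →L[ℂ] H} {D : ℤ → H →L[ℂ] H}
    (hD : ∀ j < 0, D j = 0) {x e : ℤ → H}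
    (hx : ∀ t : ℤ, x t = ∑ h : Fin k, a h (x (t - ((h : ℕ) + 1))) + e t) (t : ℤ) (N : ℕ) :
    ∑ j ∈ Finset.range N, D j (e (t - j)) =
      ∑ j ∈ Finset.range N, (D j - ∑ h : Fin k, D ((j : ℤ) - ((h : ℕ) + 1)) * a h) (x (t - j)) -
        boundaryTerm a D x t N := by
  have key : ∀ h : Fin k, ∑ j ∈ Finset.range N, D j (a h (x (t - j - ((h : ℕ) + 1)))) =
      ∑ j ∈ Finset.range N, D ((j : ℤ) - ((h : ℕ) + 1)) (a h (x (t - j))) +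
        ∑ i ∈ Finset.range ((h : ℕ) + 1),
          D ((N + i : ℕ) - ((h : ℕ) + 1)) (a h (x (t - (N + i : ℕ)))) := by
    intro h
    have h0 : ∑ j ∈ Finset.range ((h : ℕ) + 1),
        D ((j : ℤ) - ((h : ℕ) + 1)) (a h (x (t - j))) = 0 := by
      refine Finset.sum_eq_zero fun j hj => ?_
      rw [hD _ (by have := Finset.mem_range.1 hj; lia)]
      rfl
    rw [← Finset.sum_range_add (fun j : ℕ => D ((j : ℤ) - ((h : ℕ) + 1)) (a h (x (t - j)))),
      add_comm N, Finset.sum_range_add, h0, zero_add]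
    refine Finset.sum_congr rfl fun j _ => ?_
    push_cast
    congr 3
    · ring
    · ring_nf
  have he : ∀ t, e t = x t - ∑ h : Fin k, a h (x (t - ((h : ℕ) + 1))) := fun t => by
    rw [hx t]; abel
  simp only [he, map_sub, map_sum, Finset.sum_sub_distrib, boundaryTerm, sub_apply, sum_apply,
    mul_apply_eq_comp]
  rw [Finset.sum_comm (s := Finset.range N), Finset.sum_congr rfl fun h _ => key h,
    Finset.sum_add_distrib, Finset.sum_comm (s := Finset.range N)]
  abel

theorem tendsto_boundaryTerm {k : ℕ} (a : Fin k → H →L[ℂ] H) {D : ℤ → H →L[ℂ] H} {r M : ℝ}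
    (hr : 0 < r) (hD : ∀ n : ℕ, ‖D n‖ * r ^ n ≤ M) {x : ℤ → H} {ns : ℕ → ℕ}
    (hns : Tendsto ns atTop atTop)
    (hx : ∀ i < k, Tendsto (fun j => (r ^ (ns j + i))⁻¹ • x (-((ns j + i : ℕ) : ℤ))) atTop (𝓝 0))
    (t : ℤ) :
    Tendsto (fun j => boundaryTerm a D x t (ns j + t).toNat) atTop (𝓝 0) := by
  rw [show (0 : H) = ∑ h : Fin k, ∑ i ∈ Finset.range ((h : ℕ) + 1), 0 by simp]
  refine tendsto_finsetSum _ fun h _ => tendsto_finsetSum _ fun i hi => ?_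
  have hik : i < k := by have := Finset.mem_range.1 hi; have := h.2; lia
  have hlim := ((hx i hik).norm.const_mul (M * ‖a h‖ * r ^ ((h : ℤ) + 1 - t)))
  rw [norm_zero, mul_zero] at hlim
  refine squeeze_zero_norm' ?_ hlim
  filter_upwards [hns.eventually_ge_atTop ((h : ℕ) + 1 + t.natAbs)] with j hj
  -- with `N = ns j + t`, the boundary terms only involve `x` at the dates `-(ns j + i)`, `i < k`
  obtain ⟨m, hm⟩ := Int.eq_ofNat_of_zero_le (show 0 ≤ (ns j : ℤ) + t + i - ((h : ℕ) + 1) by lia)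
  rw [show (((ns j + t).toNat + i : ℕ) : ℤ) - ((h : ℕ) + 1) = (m : ℤ) by lia,
    show t - (((ns j + t).toNat + i : ℕ) : ℤ) = -((ns j + i : ℕ) : ℤ) by lia]
  set v := x (-((ns j + i : ℕ) : ℤ))
  have hpow : r ^ m * r ^ ((h : ℤ) + 1 - t) = r ^ (ns j + i) := by
    rw [← zpow_natCast, ← zpow_natCast, ← zpow_add₀ hr.ne']
    congr 1
    push_cast
    lia
  have hn : ‖(r ^ (ns j + i))⁻¹ • v‖ = (r ^ (ns j + i))⁻¹ * ‖v‖ := by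
    rw [norm_smul, norm_inv, norm_pow, Real.norm_of_nonneg hr.le]
  have hz : 0 < r ^ ((h : ℤ) + 1 - t) := zpow_pos hr _
  rw [hn]
  calc ‖D m (a h v)‖ ≤ ‖D m‖ * (‖a h‖ * ‖v‖) :=
        ((D m).le_opNorm _).trans (by gcongr; exact (a h).le_opNorm v)
    _ = (‖D m‖ * r ^ m) * (‖a h‖ * r ^ ((h : ℤ) + 1 - t)) * ((r ^ (ns j + i))⁻¹ * ‖v‖) := by
        rw [← hpow]
        field_simp
    _ ≤ M * (‖a h‖ * r ^ ((h : ℤ) + 1 - t)) * ((r ^ (ns j + i))⁻¹ * ‖v‖) := by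
        gcongr
        exact hD m
    _ = _ := by ring

variable {k : ℕ} {a : Fin k → H →L[ℂ] H} {ρ : ℝ} {d : ℕ} {C Cstar : ℕ → H →L[ℂ] H}

/-- Filtering the autoregression with the coefficients of `(1 - z)^d A(z)⁻¹` yields the `d`-th
difference of the solution, as the boundary terms vanish in the remote past. -/
theorem diffOp_iterate_eq_of_path [CompleteSpace H] (ha : IsUnitRootOfFiniteType a ρ)
    (hC : AbsConvOn Cstar ρ)
    (hinv : ∀ z ∈ Metric.ball (0 : ℂ) ρ, z ≠ 1 →
        Ring.inverse (arPoly a z) =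
          ∑ n ∈ Finset.range d, ((1 - z) ^ (d - n))⁻¹ • C n + ∑' n : ℕ, z ^ n • Cstar n)
    {x e y : ℤ → H} (hx : ∀ t : ℤ, x t = ∑ h : Fin k, a h (x (t - ((h : ℕ) + 1))) + e t)
    (hy : ∀ t, HasSum (fun n : ℕ => Cstar n (e (t - n))) (y t)) {r : ℝ} (hr : 0 < r) (hrρ : r < ρ)
    {ns : ℕ → ℕ} (hns : Tendsto ns atTop atTop)
    (hlim : ∀ i < k, Tendsto (fun j => (r ^ (ns j + i))⁻¹ • x (-((ns j + i : ℕ) : ℤ)))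
      atTop (𝓝 0)) (t : ℤ) :
    diffOp^[d] x t = ∑ n ∈ Finset.range d, C n (diffOp^[n] e t) + diffOp^[d] y t := by
  set D := clearedCoeff d C Cstar with hDdef
  have hrb : (r : ℂ) ∈ Metric.ball (0 : ℂ) ρ := by simpa [abs_of_pos hr] using hrρ
  obtain ⟨M, hM⟩ := (hasSum_pow_smul_clearedCoeff d C
    (summable_pow_smul_of_absConvOn hC hrb).hasSum).summable.tendsto_atTop_zero.norm.bddAbove_range
  have hDM : ∀ n : ℕ, ‖D n‖ * r ^ n ≤ M := fun n => by
    have := hM ⟨n, rfl⟩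
    simpa [norm_smul, abs_of_pos hr, mul_comm] using this
  have hN : Tendsto (fun j => (ns j + t).toNat) atTop atTop := by
    refine tendsto_atTop.2 fun b => ?_
    filter_upwards [hns.eventually_ge_atTop (b + t.natAbs)] with j hj
    lia
  have h1 := (hasSum_clearedCoeff_apply d C hy t).tendsto_sum_nat.comp hN
  have h2 := (hasSum_diffOp_iterate_apply (constCoeff_of_neg (1 : H →L[ℂ] H)) (w := x) (u := x)
    (fun t => hasSum_constCoeff_apply 1 x t) d t).tendsto_sum_nat.comp hN
  have h3 := h2.sub (tendsto_boundaryTerm a hr hDM hns hlim t)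
  rw [sub_zero] at h3
  refine tendsto_nhds_unique h3 (h1.congr fun j => ?_)
  simp only [Function.comp_apply]
  rw [sum_apply_eq_sub_boundaryTerm (clearedCoeff_of_neg d C Cstar) hx]
  simp only [clearedCoeff_sub_sum ha hC hinv]
  rfl

/-- The coordinate of the initial values that carries the noise at the date `t`, and zero if
there is none. -/
noncomputable def noiseCoord (d : ℕ) (t : ℤ) : (Fin (d + 1) → H × H × H) →L[ℂ] H :=
  if -(d : ℤ) ≤ t ∧ t ≤ 0 then
    (ContinuousLinearMap.snd ℂ H H).comp ((ContinuousLinearMap.snd ℂ H (H × H)).comp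
      (ContinuousLinearMap.proj (Fin.ofNat (d + 1) (-t).toNat)))
  else 0

/-- The value of `x - y - ∑ C_m s_{d-m}` at the date `-j`, as a function of the initial values. -/
noncomputable def remainderCoord (d : ℕ) (C : ℕ → H →L[ℂ] H) (j : ℕ) :
    (Fin (d + 1) → H × H × H) →L[ℂ] H :=
  (ContinuousLinearMap.fst ℂ H (H × H)).comp (ContinuousLinearMap.proj (Fin.ofNat (d + 1) j)) -
    (ContinuousLinearMap.fst ℂ H H).comp ((ContinuousLinearMap.snd ℂ H (H × H)).comp
      (ContinuousLinearMap.proj (Fin.ofNat (d + 1) j))) -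
    ∑ m ∈ Finset.range d, (C m).comp (commonTrend (noiseCoord d) (d - m) (-(j : ℤ)))

/-- The `n`-th coefficient of the polynomial that interpolates `x - y - ∑ C_m s_{d-m}` at the dates
`0, -1, …, -(d - 1)`. -/
noncomputable def trendCoeff (d : ℕ) (C : ℕ → H →L[ℂ] H) (n : ℕ) :
    (Fin (d + 1) → H × H × H) →L[ℂ] H :=
  ∑ j ∈ Finset.range d, (lagrangePoly d j).coeff n • remainderCoord d C j

/-- The trends at the dates `0, …, -d` depend on the noise at these dates only. -/
theorem remainderCoord_apply (d : ℕ) (C : ℕ → H →L[ℂ] H) {j : ℕ} (hj : j < d) (x y e : ℤ → H) :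
    remainderCoord d C j (fun i => (x (-((i : ℕ) : ℤ)), y (-((i : ℕ) : ℤ)), e (-((i : ℕ) : ℤ)))) =
      x (-(j : ℤ)) - y (-(j : ℤ)) -
        ∑ m ∈ Finset.range d, C m (commonTrend e (d - m) (-(j : ℤ))) := by
  set v : Fin (d + 1) → H × H × H :=
    fun i => (x (-((i : ℕ) : ℤ)), y (-((i : ℕ) : ℤ)), e (-((i : ℕ) : ℤ))) with hv
  have htrend : ∀ h, commonTrend (noiseCoord d) h (-(j : ℤ)) v = commonTrend e h (-(j : ℤ)) := by
    intro h
    have h1 := commonTrend_map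
      ((ContinuousLinearMap.apply ℂ H v : _ →ₗ[ℂ] H).toAddMonoidHom) (noiseCoord (H := H) d) h
      (-(j : ℤ))
    refine Eq.trans h1.symm (commonTrend_congr (m := -(d : ℤ)) (fun t ht ht0 => ?_) h _
      (by lia) (by lia))
    have hmod : (-t).toNat % (d + 1) = (-t).toNat := Nat.mod_eq_of_lt (by lia)
    have hval : -(((-t).toNat : ℕ) : ℤ) = t := by lia
    simp only [LinearMap.toAddMonoidHom_coe, ContinuousLinearMap.coe_coe,
      ContinuousLinearMap.apply_apply, noiseCoord, if_pos (And.intro ht ht0)]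
    simp [hv, Fin.ofNat, hmod, -Int.ofNat_toNat, hval]
  have hmod : j % (d + 1) = j := Nat.mod_eq_of_lt (by lia)
  simp only [remainderCoord, sub_apply, sum_apply, ContinuousLinearMap.comp_apply, htrend]
  simp [hv, Fin.ofNat, hmod]

/-- The common trends representation along one path. -/
theorem commonTrends_of_path [CompleteSpace H] (ha : IsUnitRootOfFiniteType a ρ)
    (hC : AbsConvOn Cstar ρ)
    (hinv : ∀ z ∈ Metric.ball (0 : ℂ) ρ, z ≠ 1 →
        Ring.inverse (arPoly a z) =
          ∑ n ∈ Finset.range d, ((1 - z) ^ (d - n))⁻¹ • C n + ∑' n : ℕ, z ^ n • Cstar n)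
    {x e y : ℤ → H} (hx : ∀ t : ℤ, x t = ∑ h : Fin k, a h (x (t - ((h : ℕ) + 1))) + e t)
    (hy : ∀ t, HasSum (fun n : ℕ => Cstar n (e (t - n))) (y t)) {r : ℝ} (hr : 0 < r) (hrρ : r < ρ)
    {ns : ℕ → ℕ} (hns : Tendsto ns atTop atTop)
    (hlim : ∀ i < k, Tendsto (fun j => (r ^ (ns j + i))⁻¹ • x (-((ns j + i : ℕ) : ℤ)))
      atTop (𝓝 0)) (t : ℤ) :
    x t = ∑ n ∈ Finset.range d, C n (commonTrend e (d - n) t) + y t +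
      ∑ n ∈ Finset.range d, (t : ℂ) ^ n • trendCoeff d C n
        (fun i => (x (-((i : ℕ) : ℤ)), y (-((i : ℕ) : ℤ)), e (-((i : ℕ) : ℤ)))) := by
  set w : ℤ → H := fun t => x t - y t - ∑ n ∈ Finset.range d, C n (commonTrend e (d - n) t)
    with hwdef
  have hw : diffOp^[d] w = 0 := by
    rw [hwdef, diffOp_iterate_sub, diffOp_iterate_sub, diffOp_iterate_sum]
    funext t
    beta_reduce
    rw [diffOp_iterate_eq_of_path ha hC hinv hx hy hr hrρ hns hlim t, add_sub_cancel_right,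
      Pi.zero_apply, sub_eq_zero]
    refine Finset.sum_congr rfl fun n hn => ?_
    have := congrFun (diffOp_iterate_map ((C n : H →ₗ[ℂ] H).toAddMonoidHom)
      (commonTrend e (d - n)) d) t
    rw [diffOp_iterate_commonTrend e (Finset.mem_range.1 hn).le] at this
    exact this.symm
  have hV : ∀ n, trendCoeff d C n
      (fun i => (x (-((i : ℕ) : ℤ)), y (-((i : ℕ) : ℤ)), e (-((i : ℕ) : ℤ)))) =
        ∑ j ∈ Finset.range d, (lagrangePoly d j).coeff n • w (-(j : ℤ)) := by
    intro n
    simp only [trendCoeff, sum_apply, smul_apply]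
    refine Finset.sum_congr rfl fun j hj => ?_
    rw [remainderCoord_apply d C (Finset.mem_range.1 hj)]
  simp only [hV]
  rw [← eq_sum_pow_smul_of_diffOp_iterate_eq_zero hw t]
  simp only [hwdef]
  abel

end Path

/-! ### Linear processes in white noise -/

section WhiteNoise

variable {H : Type*} [NormedAddCommGroup H] [InnerProductSpace ℂ H]

/-- Orthonormal vectors are at distance `√2`, hence have disjoint neighbourhoods. -/
theorem countable_of_hilbertBasis {ι : Type*} [TopologicalSpace.SeparableSpace H]
    (b : HilbertBasis ι ℂ H) : Countable ι := by
  have hd : ∀ i j, i ≠ j → 1 ≤ dist (b i) (b j) := by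
    intro i j hij
    have h1 : ‖b i - b j‖ ^ 2 = 2 := by
      rw [@norm_sub_sq ℂ, b.orthonormal.1 i, b.orthonormal.1 j, b.orthonormal.2 hij]
      norm_num
    rw [dist_eq_norm]
    nlinarith [norm_nonneg (b i - b j)]
  refine Set.countable_univ_iff.1 (Set.PairwiseDisjoint.countable_of_isOpen
    (s := fun i => Metric.ball (b i) (1 / 2)) (a := Set.univ) ?_ (fun _ _ => Metric.isOpen_ball)
    fun i _ => ⟨b i, Metric.mem_ball_self (by norm_num)⟩)
  intro i _ j _ hij
  exact Metric.ball_disjoint_ball (by linarith [hd i j hij])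

theorem tsum_enorm_inner_sq {ι : Type*} (b : HilbertBasis ι ℂ H) (x : H) :
    ∑' i, ‖(inner ℂ (b i) x : ℂ)‖ₑ ^ 2 = ‖x‖ₑ ^ 2 := by
  have h1 : HasSum (fun i => ‖(inner ℂ (b i) x : ℂ)‖ ^ 2) (‖x‖ ^ 2) := by
    have := (b.hasSum_inner_mul_inner x x).mapL Complex.reCLM
    rw [inner_self_eq_norm_sq_to_K] at this
    convert this using 1
    · funext i
      rw [← inner_conj_symm, RCLike.mul_conj]
      simp [← Complex.ofReal_pow, norm_inner_symm]
    · simp [← Complex.ofReal_pow]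
  have h2 := ENNReal.ofReal_tsum_of_nonneg (fun i => sq_nonneg ‖(inner ℂ (b i) x : ℂ)‖) h1.summable
  rw [h1.tsum_eq] at h2
  simpa [ENNReal.ofReal_pow] using h2.symm

variable {Ω : Type*} [MeasurableSpace Ω] [CompleteSpace H]

/-- The second moment of a scalar component is a diagonal entry of the covariance operator. -/
theorem lintegral_enorm_inner_sq {P : Measure Ω} {Z : Ω → H} (hZ : MemLp Z 2 P) (w : H) :
    ∫⁻ ω, ‖(inner ℂ w (Z ω) : ℂ)‖ₑ ^ 2 ∂P = ENNReal.ofReal (inner ℂ w (covOp P Z w) : ℂ).re := by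
  have hinn : MemLp (fun ω => (inner ℂ w (Z ω) : ℂ)) 2 P := hZ.const_inner w
  have hint : Integrable (fun ω => (inner ℂ (Z ω) w : ℂ) • Z ω) P := by
    refine Integrable.mono' (hZ.integrable_norm_pow (by norm_num) |>.const_mul ‖w‖)
      ((hZ.aestronglyMeasurable.inner aestronglyMeasurable_const).smul hZ.aestronglyMeasurable)
      (Eventually.of_forall fun ω => ?_)
    rw [norm_smul]
    calc _ ≤ (‖Z ω‖ * ‖w‖) * ‖Z ω‖ := by gcongr; exact norm_inner_le_norm _ _
      _ = _ := by simp; ring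
  rw [covOp, ← integral_inner hint]
  have h1 : ∀ ω, (inner ℂ w ((inner ℂ (Z ω) w : ℂ) • Z ω) : ℂ) =
      ((‖(inner ℂ w (Z ω) : ℂ)‖ ^ 2 : ℝ) : ℂ) := by
    intro ω
    rw [inner_smul_right, ← inner_conj_symm, RCLike.conj_mul]
    simp
  simp only [h1]
  rw [integral_complex_ofReal, Complex.ofReal_re,
    ofReal_integral_eq_lintegral_ofReal (hinn.integrable_norm_pow (by norm_num))
      (Eventually.of_forall fun ω => by positivity)]
  simp [ENNReal.ofReal_pow]

variable [TopologicalSpace.SeparableSpace H] [MeasurableSpace H] {P : Measure Ω}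
  {ε : ℤ → Ω → H}

/-- By Parseval's identity the second moment is the trace of the covariance operator, hence it is
constant in time. -/
theorem IsWeaklyStationary.eLpNorm_eq (hε : IsWeaklyStationary P ε) (s t : ℤ) :
    eLpNorm (ε s) 2 P = eLpNorm (ε t) 2 P := by
  obtain ⟨w, b, -⟩ := exists_hilbertBasis ℂ H
  have : Countable w := countable_of_hilbertBasis b
  have h1 : ∀ t, ∫⁻ ω, ‖ε t ω‖ₑ ^ 2 ∂P =
      ∑' i, ENNReal.ofReal (inner ℂ (b i) (covOp P (ε t) (b i)) : ℂ).re := by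
    intro t
    simp only [← tsum_enorm_inner_sq b]
    rw [lintegral_tsum fun i => ?_]
    · simp only [lintegral_enorm_inner_sq (hε.memLp t)]
    · exact ((hε.memLp t).aestronglyMeasurable.const_inner.enorm.pow_const 2)
  have h2 : ∀ t, eLpNorm (ε t) 2 P ^ 2 = ∫⁻ ω, ‖ε t ω‖ₑ ^ 2 ∂P := by
    intro t
    have := eLpNorm_nnreal_pow_eq_lintegral (μ := P) (f := ε t) (p := 2) (by norm_num)
    simpa only [NNReal.coe_ofNat, ENNReal.coe_ofNat, ENNReal.rpow_ofNat] using this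
  have h3 := (h2 s).trans (((h1 s).trans (by rw [hε.covOp_const s t, ← h1 t])).trans (h2 t).symm)
  exact (ENNReal.pow_right_strictMono two_ne_zero).injective h3

theorem eLpNorm_clm_apply_le (hε : IsWhiteNoise P ε) (T : H →L[ℂ] H) (t : ℤ) :
    eLpNorm (fun ω => T (ε t ω)) 2 P ≤ ‖T‖ₑ * eLpNorm (ε 0) 2 P := by
  rw [hε.weaklyStationary.eLpNorm_eq 0 t]
  have := eLpNorm_le_nnreal_smul_eLpNorm_of_ae_le_mul (μ := P) (f := fun ω => T (ε t ω))
    (g := ε t) (c := ‖T‖₊) (Eventually.of_forall fun ω => T.le_opNNNorm _) 2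
  rwa [ENNReal.smul_def, smul_eq_mul] at this

end WhiteNoise

section LinearProcess

variable {H : Type*} [NormedAddCommGroup H]
  {Ω : Type*} [MeasurableSpace Ω] {P : Measure Ω} {ε : ℤ → Ω → H}

/-- Convergence in probability to zero passes to blocks of `k` consecutive terms, hence to an almost
surely convergent subsequence of the blocks. -/
theorem exists_seq_ae_tendsto_block {f : ℕ → Ω → H}
    (hf : TendstoInMeasure P f atTop fun _ => 0) (k : ℕ) :
    ∃ ns : ℕ → ℕ, Tendsto ns atTop atTop ∧
      ∀ᵐ ω ∂P, ∀ i < k, Tendsto (fun j => f (ns j + i) ω) atTop (𝓝 0) := by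
  let F : ℕ → Ω → (Fin k → H) := fun N ω i => f (N + i) ω
  have hF : TendstoInMeasure P F atTop fun _ => 0 := by
    rw [tendstoInMeasure_iff_norm] at hf ⊢
    intro δ hδ
    have h1 : Tendsto (fun N => ∑ i : Fin k, P {ω | δ ≤ ‖f (N + i) ω - 0‖}) atTop (𝓝 0) := by
      rw [show (0 : ENNReal) = ∑ i : Fin k, 0 by simp]
      exact tendsto_finsetSum _ fun i _ => (hf δ hδ).comp (tendsto_add_atTop_nat i)
    refine tendsto_of_tendsto_of_tendsto_of_le_of_le tendsto_const_nhds h1 (fun _ => zero_le)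
      fun N => ?_
    refine (measure_mono ?_).trans (measure_iUnion_fintype_le P _)
    intro ω hω
    by_contra hcon
    simp only [Set.mem_iUnion, Set.mem_ofPred_eq, not_exists, not_le, sub_zero] at hcon hω
    exact absurd ((pi_norm_lt_iff hδ).2 hcon) (not_lt.2 hω)
  obtain ⟨ns, hns, hlim⟩ := hF.exists_seq_tendsto_ae
  refine ⟨ns, hns.tendsto_atTop, ?_⟩
  filter_upwards [hlim] with ω hω i hi
  exact (tendsto_pi_nhds.1 hω) ⟨i, hi⟩

variable [InnerProductSpace ℂ H] {B : ℕ → H →L[ℂ] H}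

theorem summable_norm_of_absConvOn {ρ : ℝ} (hρ : 1 < ρ) (hB : AbsConvOn B ρ) :
    Summable fun n => ‖B n‖ := by
  simpa using hB 1 (by simpa using hρ)

variable [MeasurableSpace H]

theorem tsum_enorm_mul_ne_top (hε : IsWhiteNoise P ε) (hB : Summable fun n => ‖B n‖) :
    ∑' n, ‖B n‖ₑ * eLpNorm (ε 0) 2 P ≠ ⊤ := by
  rw [ENNReal.tsum_mul_right]
  refine ENNReal.mul_ne_top ?_ (hε.weaklyStationary.memLp 0).eLpNorm_ne_top
  have : (∑' n, ‖B n‖ₑ) = ENNReal.ofReal (∑' n, ‖B n‖) := by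
    rw [ENNReal.ofReal_tsum_of_nonneg (fun n => norm_nonneg _) hB]
    simp
  rw [this]
  exact ENNReal.ofReal_ne_top

theorem memLp_clm_apply (hε : IsWhiteNoise P ε) (T : H →L[ℂ] H) (t : ℤ) :
    MemLp (fun ω => T (ε t ω)) 2 P :=
  T.comp_memLp' (hε.weaklyStationary.memLp t)

variable [IsProbabilityMeasure P]

theorem integrable_commonTrend (hε : IsWhiteNoise P ε) (h : ℕ) :
    ∀ t, Integrable (commonTrend ε h t) P ∧ ∫ ω, commonTrend ε h t ω ∂P = 0 := by
  unfold commonTrend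
  induction h with
  | zero =>
    exact fun t => ⟨(hε.weaklyStationary.memLp t).integrable (by norm_num), hε.mean_zero t⟩
  | succ h ih =>
    have hsum : ∀ s : Finset ℤ, Integrable (∑ i ∈ s, cumOp^[h] ε i) P ∧
        ∫ ω, (∑ i ∈ s, cumOp^[h] ε i) ω ∂P = 0 := by
      intro s
      refine ⟨integrable_finsetSum' _ fun i _ => (ih i).1, ?_⟩
      simp only [Finset.sum_apply]
      rw [integral_finsetSum _ fun i _ => (ih i).1]
      exact Finset.sum_eq_zero fun i _ => (ih i).2
    intro t
    rw [Function.iterate_succ_apply', cumOp]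
    split_ifs
    · exact hsum _
    · exact ⟨(hsum _).1.neg, by simp only [Pi.neg_apply, integral_neg, (hsum _).2, neg_zero]⟩
    · exact ⟨integrable_zero _ _ _, by simp⟩

variable [CompleteSpace H] [TopologicalSpace.SeparableSpace H]

theorem ae_summable_norm_lagFilter (hε : IsWhiteNoise P ε) (hB : Summable fun n => ‖B n‖) :
    ∀ᵐ ω ∂P, ∀ t : ℤ, Summable fun n : ℕ => ‖B n (ε (t - n) ω)‖ := by
  rw [ae_all_iff]
  intro t
  have h1 : ∫⁻ ω, ∑' n : ℕ, ‖B n (ε (t - n) ω)‖ₑ ∂P ≠ ⊤ := by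
    rw [lintegral_tsum fun n => (memLp_clm_apply hε (B n) (t - n)).aestronglyMeasurable.enorm]
    refine ne_top_of_le_ne_top (tsum_enorm_mul_ne_top hε hB) (ENNReal.tsum_le_tsum fun n => ?_)
    rw [← eLpNorm_one_eq_lintegral_enorm]
    exact (eLpNorm_le_eLpNorm_of_exponent_le (by norm_num)
      (memLp_clm_apply hε (B n) (t - n)).aestronglyMeasurable).trans
      (eLpNorm_clm_apply_le hε (B n) (t - n))
  have h2 := ae_lt_top' (AEMeasurable.tsum fun n : ℕ =>
    (memLp_clm_apply hε (B n) (t - n)).aestronglyMeasurable.enorm) h1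
  filter_upwards [h2] with ω hω
  have := ENNReal.summable_toReal hω.ne
  simpa using this

theorem ae_hasSum_lagFilter (hε : IsWhiteNoise P ε) (hB : Summable fun n => ‖B n‖) :
    ∀ᵐ ω ∂P, ∀ t : ℤ, HasSum (fun n : ℕ => B n (ε (t - n) ω)) (lagFilter B ε t ω) := by
  filter_upwards [ae_summable_norm_lagFilter hε hB] with ω hω t
  exact (hω t).of_norm.hasSum

/-- Minkowski's inequality for the tails, by Fatou's lemma. -/
theorem tendsto_eLpNorm_lagFilter_sub (hε : IsWhiteNoise P ε) (hB : Summable fun n => ‖B n‖)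
    (t : ℤ) : Tendsto (fun N : ℕ => eLpNorm (fun ω => lagFilter B ε t ω -
      ∑ n ∈ Finset.range N, B n (ε (t - n) ω)) 2 P) atTop (𝓝 0) := by
  have hmeas : ∀ n : ℕ, AEStronglyMeasurable (fun ω => B n (ε (t - n) ω)) P :=
    fun n => (memLp_clm_apply hε (B n) (t - n)).aestronglyMeasurable
  refine tendsto_of_tendsto_of_tendsto_of_le_of_le tendsto_const_nhds
    (ENNReal.tendsto_sum_nat_add _ (tsum_enorm_mul_ne_top hε hB)) (fun _ => zero_le) fun N => ?_
  have hFatou := Lp.eLpNorm_lim_le_liminf_eLpNorm (μ := P) (p := 2)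
    (f := fun M ω => ∑ n ∈ Finset.range M, B (n + N) (ε (t - (n + N : ℕ)) ω))
    (fun M => Finset.aestronglyMeasurable_fun_sum _ fun n _ => hmeas (n + N))
    (fun ω => lagFilter B ε t ω - ∑ n ∈ Finset.range N, B n (ε (t - n) ω)) (by
      filter_upwards [ae_hasSum_lagFilter hε hB] with ω hω
      exact ((hasSum_nat_add_iff' N).2 (hω t)).tendsto_sum_nat)
  refine hFatou.trans (liminf_le_of_le (by isBoundedDefault) fun b hb => ?_)
  obtain ⟨M, hM⟩ := hb.exists
  have hsum := eLpNorm_sum_le (μ := P) (p := 2) (s := Finset.range M)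
    (f := fun n ω => B (n + N) (ε (t - (n + N : ℕ)) ω)) (fun n _ => hmeas (n + N)) (by norm_num)
  rw [Finset.sum_fn] at hsum
  refine hM.trans (hsum.trans (le_trans ?_ (ENNReal.sum_le_tsum (Finset.range M))))
  exact Finset.sum_le_sum fun n _ => eLpNorm_clm_apply_le hε _ _

theorem memLp_lagFilter (hε : IsWhiteNoise P ε) (hB : Summable fun n => ‖B n‖) (t : ℤ) :
    MemLp (lagFilter B ε t) 2 P := by
  have hmeas : ∀ n : ℕ, MemLp (fun ω => B n (ε (t - n) ω)) 2 P :=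
    fun n => memLp_clm_apply hε (B n) (t - n)
  have hS : ∀ N : ℕ, MemLp (fun ω => ∑ n ∈ Finset.range N, B n (ε (t - n) ω)) 2 P :=
    fun N => memLp_finsetSum _ fun n _ => hmeas n
  have hy : AEStronglyMeasurable (lagFilter B ε t) P := by
    refine aestronglyMeasurable_of_tendsto_ae atTop (fun N => (hS N).aestronglyMeasurable) ?_
    filter_upwards [ae_hasSum_lagFilter hε hB] with ω hω
    exact (hω t).tendsto_sum_nat
  obtain ⟨N, hN⟩ := ((tendsto_eLpNorm_lagFilter_sub hε hB t).eventually_lt_const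
    ENNReal.zero_lt_top).exists
  have h1 : MemLp (fun ω => lagFilter B ε t ω - ∑ n ∈ Finset.range N, B n (ε (t - n) ω)) 2 P :=
    ⟨hy.sub (hS N).aestronglyMeasurable, hN⟩
  exact (h1.add (hS N)).ae_eq (Eventually.of_forall fun ω => by simp)

theorem integral_lagFilter (hε : IsWhiteNoise P ε) (hB : Summable fun n => ‖B n‖) (t : ℤ) :
    ∫ ω, lagFilter B ε t ω ∂P = 0 := by
  have hmem : ∀ n : ℕ, MemLp (fun ω => B n (ε (t - n) ω)) 2 P :=
    fun n => memLp_clm_apply hε (B n) (t - n)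
  have hε1 : ∀ t, Integrable (ε t) P := fun t =>
    (hε.weaklyStationary.memLp t).integrable (by norm_num)
  have hnorm := hasSum_integral_of_summable_integral_norm
    (fun n => (hmem n).integrable (by norm_num)) (μ := P) ?_
  · refine hnorm.unique ?_
    convert hasSum_zero with n
    rw [(B n).integral_comp_comm (hε1 _), hε.mean_zero, map_zero]
  · refine Summable.of_nonneg_of_le (fun n => by positivity) (fun n => ?_)
      (hB.mul_right (eLpNorm (ε 0) 2 P).toReal)
    rw [integral_norm_eq_lintegral_enorm (hmem n).aestronglyMeasurable,
      ← eLpNorm_one_eq_lintegral_enorm, ← toReal_enorm (B n), ← ENNReal.toReal_mul]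
    refine ENNReal.toReal_mono (ENNReal.mul_ne_top enorm_ne_top
      (hε.weaklyStationary.memLp 0).eLpNorm_ne_top) ?_
    exact (eLpNorm_le_eLpNorm_of_exponent_le (by norm_num) (hmem n).aestronglyMeasurable).trans
      (eLpNorm_clm_apply_le hε (B n) (t - n))

theorem isLinearProcess_lagFilter (hε : IsWhiteNoise P ε) {ρ : ℝ} (hρ : 1 < ρ)
    (hB : AbsConvOn B ρ) : IsLinearProcess P ε B (lagFilter B ε) where
  whiteNoise := hε
  absConv := ⟨ρ, hρ, hB⟩
  integrable t := (memLp_lagFilter hε (summable_norm_of_absConvOn hρ hB) t).integrable (by norm_num)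
  meanSquare t := by
    rw [integral_lagFilter hε (summable_norm_of_absConvOn hρ hB)]
    simpa using tendsto_eLpNorm_lagFilter_sub hε (summable_norm_of_absConvOn hρ hB) t

/-- White noise is `I(0)`, with the coefficients `B_0 = I` and `B_n = 0` for `n ≥ 1`. -/
theorem isIZero_self [Nontrivial H] (hε : IsWhiteNoise P ε) : IsIZero P ε ε := by
  let B : ℕ → H →L[ℂ] H := fun n => if n = 0 then 1 else 0
  have hB0 : ∀ n ≠ 0, B n = 0 := fun n hn => if_neg hn
  have hfilter : lagFilter B ε = ε := by
    funext t ω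
    rw [lagFilter, tsum_eq_single 0 fun n hn => by rw [hB0 n hn]; rfl]
    simp [B]
  have hlin := isLinearProcess_lagFilter (B := B) hε one_lt_two fun z _ =>
    summable_of_ne_finset_zero (s := {0}) fun n hn => by
      rw [hB0 n (by simpa using hn), norm_zero, zero_mul]
  rw [hfilter] at hlin
  refine ⟨B, hlin, rfl, ?_⟩
  rw [tsum_eq_single 0 hB0]
  exact one_ne_zero

theorem isIntegratedOfOrder_commonTrend [Nontrivial H] (hε : IsWhiteNoise P ε) (h : ℕ) :
    IsIntegratedOfOrder P ε h (commonTrend ε h) := by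
  have := diffOp_iterate_commonTrend ε (Nat.zero_le h)
  rw [Nat.sub_zero] at this
  rw [IsIntegratedOfOrder, this]
  exact isIZero_self hε

end LinearProcess

end HilbertAR

/-! ### The common trends representation -/

open HilbertAR in
theorem mainTheorem2 {H : Type*} [NormedAddCommGroup H] [InnerProductSpace ℂ H] [CompleteSpace H]
    [TopologicalSpace.SeparableSpace H] [MeasurableSpace H] [BorelSpace H]
    {k : ℕ} (a : Fin k → H →L[ℂ] H) (ρ : ℝ) (ha : IsUnitRootOfFiniteType a ρ) :
    ∃ (d : ℕ) (C Cstar : ℕ → H →L[ℂ] H)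
      (V : ℕ → (Fin (d + 1) → H × H × H) →L[ℂ] H),
      -- the inverse has a pole of order `d` at `1`, with finite rank principal part
      1 ≤ d ∧
      (meromorphicOrderAt (fun z => Ring.inverse (arPoly a z)) 1 = ((-(d : ℤ) : ℤ) : WithTop ℤ)) ∧
      MeromorphicAt (fun z => Ring.inverse (arPoly a z)) 1 ∧
      C 0 ≠ 0 ∧
      (∀ n < d, FiniteDimensional ℂ (C n).range) ∧
      AbsConvOn Cstar ρ ∧
      (∀ z ∈ Metric.ball (0 : ℂ) ρ, z ≠ 1 →
        Ring.inverse (arPoly a z) =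
          ∑ n ∈ Finset.range d, ((1 - z) ^ (d - n))⁻¹ • C n + ∑' n : ℕ, z ^ n • Cstar n) ∧
      -- the common trends representation of every solution
      ∀ {Ω : Type*} [MeasurableSpace Ω] (P : Measure Ω) [IsProbabilityMeasure P]
        (ε x : ℤ → Ω → H), IsWhiteNoise P ε → SolvesAR P a ε x → NonexplosivePast P ρ x →
        (∀ᵐ ω ∂P, ∀ t : ℤ,
          x t ω = ∑ n ∈ Finset.range d, C n (commonTrend ε (d - n) t ω) + lagFilter Cstar ε t ω +
            ∑ n ∈ Finset.range d, (t : ℂ) ^ n • V n (initialValues d x (lagFilter Cstar ε) ε ω)) ∧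
        (∀ h, 1 ≤ h → IsIntegratedOfOrder P ε h (commonTrend ε h)) ∧
        (∀ᵐ ω ∂P, ∀ t : ℤ, Summable fun n : ℕ => ‖Cstar n (ε (t - n) ω)‖) ∧
        IsLinearProcess P ε Cstar (lagFilter Cstar ε) ∧
        -- the expectation of `x_t`
        ((∀ t, Integrable (x t) P) →
          (∀ n < d, Integrable (fun ω => V n (initialValues d x (lagFilter Cstar ε) ε ω)) P) ∧
          ∀ t : ℤ, ∫ ω, x t ω ∂P = ∑ n ∈ Finset.range d, (t : ℂ) ^ n •
            ∫ ω, V n (initialValues d x (lagFilter Cstar ε) ε ω) ∂P) ∧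
        (∀ c : ℕ → H, (∀ n < d, ∀ᵐ ω ∂P, V n (initialValues d x (lagFilter Cstar ε) ε ω) = c n) →
          ∀ t : ℤ, Integrable (x t) P ∧
            ∫ ω, x t ω ∂P = ∑ n ∈ Finset.range d, (t : ℂ) ^ n • c n) := by
  obtain ⟨d, C, Cstar, hd, hord, hC0, hfin, hCstar, hinv⟩ := exists_laurent_inverse_arPoly ha
  have hnt : Nontrivial H := by
    obtain ⟨v, hv, -⟩ := ha.eigenvalue.exists_ker
    exact ⟨v, 0, hv⟩
  have hsum := summable_norm_of_absConvOn ha.one_lt hCstar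
  refine ⟨d, C, Cstar, trendCoeff d C, hd, hord,
    meromorphicAt_inverse_of_isEigenvalueOfFiniteType (analyticAt_arPoly a 1) ha.eigenvalue,
    hC0, hfin, hCstar, hinv, ?_⟩
  intro Ω _ P _ ε x hε hx hpast
  have hrep : ∀ᵐ ω ∂P, ∀ t : ℤ,
      x t ω = ∑ n ∈ Finset.range d, C n (commonTrend ε (d - n) t ω) + lagFilter Cstar ε t ω +
        ∑ n ∈ Finset.range d, (t : ℂ) ^ n •
          trendCoeff d C n (initialValues d x (lagFilter Cstar ε) ε ω) := by
    obtain ⟨r, hr, hrρ, hlim⟩ := hpast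
    obtain ⟨ns, hns, hlim'⟩ := exists_seq_ae_tendsto_block hlim k
    filter_upwards [hlim', ae_all_iff.2 hx.equation, ae_hasSum_lagFilter hε hsum] with ω h1 h2 h3 t
    have h4 : ∀ h, commonTrend (fun s => ε s ω) h t = commonTrend ε h t ω := fun h =>
      commonTrend_map (Pi.evalAddMonoidHom (fun _ => H) ω) ε h t
    have := commonTrends_of_path ha hCstar hinv (x := fun s => x s ω) (e := fun s => ε s ω)
      h2 h3 hr hrρ hns h1 t
    simp only [h4] at this
    exact this
  have hy : ∀ t, Integrable (lagFilter Cstar ε t) P ∧ ∫ ω, lagFilter Cstar ε t ω ∂P = 0 := fun t =>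
    ⟨(memLp_lagFilter hε hsum t).integrable (by norm_num), integral_lagFilter hε hsum t⟩
  have hCs : ∀ n t, Integrable (fun ω => C n (commonTrend ε (d - n) t ω)) P ∧
      ∫ ω, C n (commonTrend ε (d - n) t ω) ∂P = 0 := fun n t => by
    have := integrable_commonTrend hε (d - n) t
    exact ⟨(C n).integrable_comp this.1, by
      rw [(C n).integral_comp_comm this.1, this.2, map_zero]⟩
  -- the purely stochastic part of the representation is integrable with mean zero
  have hstoch : ∀ t, Integrable (fun ω => ∑ n ∈ Finset.range d, C n (commonTrend ε (d - n) t ω) +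
      lagFilter Cstar ε t ω) P ∧ ∫ ω, (∑ n ∈ Finset.range d, C n (commonTrend ε (d - n) t ω) +
      lagFilter Cstar ε t ω) ∂P = 0 := fun t => by
    have h1 := integrable_finsetSum (Finset.range d) fun n _ => (hCs n t).1
    refine ⟨h1.add (hy t).1, ?_⟩
    rw [integral_add h1 (hy t).1, (hy t).2, integral_finsetSum _ fun n _ => (hCs n t).1]
    simp [(hCs _ t).2]
  -- `v` is either the family of trend coefficients itself or a family of constants
  have hmean : ∀ t, ∀ v : ℕ → Ω → H, (∀ n < d, Integrable (v n) P) →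
      (∀ n < d, v n =ᵐ[P] fun ω => trendCoeff d C n (initialValues d x (lagFilter Cstar ε) ε ω)) →
      Integrable (x t) P ∧
        ∫ ω, x t ω ∂P = ∑ n ∈ Finset.range d, (t : ℂ) ^ n • ∫ ω, v n ω ∂P := by
    intro t v hv hveq
    have h1 : ∀ n ∈ Finset.range d, Integrable (fun ω => (t : ℂ) ^ n • v n ω) P := fun n hn =>
      (hv n (Finset.mem_range.1 hn)).smul _
    have h2 := integrable_finsetSum (Finset.range d) h1
    have hall : ∀ᵐ ω ∂P, ∀ n : Fin d,
        v n ω = trendCoeff d C n (initialValues d x (lagFilter Cstar ε) ε ω) :=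
      ae_all_iff.2 fun n => hveq n n.2
    have h3 : x t =ᵐ[P] fun ω => (∑ n ∈ Finset.range d, C n (commonTrend ε (d - n) t ω) +
        lagFilter Cstar ε t ω) + ∑ n ∈ Finset.range d, (t : ℂ) ^ n • v n ω := by
      filter_upwards [hrep, hall] with ω hω hvω
      rw [hω t]
      congr 1
      exact Finset.sum_congr rfl fun n hn => by rw [hvω ⟨n, Finset.mem_range.1 hn⟩]
    refine ⟨((hstoch t).1.add h2).congr h3.symm, ?_⟩
    rw [integral_congr_ae h3, integral_add (hstoch t).1 h2, (hstoch t).2, zero_add,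
      integral_finsetSum _ h1]
    exact Finset.sum_congr rfl fun n _ => integral_smul _ _
  refine ⟨hrep, fun h _ => isIntegratedOfOrder_commonTrend hε h,
    ae_summable_norm_lagFilter hε hsum, isLinearProcess_lagFilter hε ha.one_lt hCstar, ?_, ?_⟩
  · intro hxint
    have hV : ∀ n, Integrable
        (fun ω => trendCoeff d C n (initialValues d x (lagFilter Cstar ε) ε ω)) P := fun n => by
      refine (trendCoeff d C n).integrable_comp (Integrable.of_eval fun j => ?_)
      exact (hxint _).prodMk ((hy _).1.prodMk
        ((hε.weaklyStationary.memLp _).integrable (by norm_num)))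
    exact ⟨fun n _ => hV n, fun t => (hmean t _ (fun n _ => hV n) fun n _ => ae_eq_rfl).2⟩
  · intro c hc t
    obtain ⟨h1, h2⟩ := hmean t (fun n _ => c n) (fun n _ => integrable_const _)
      fun n hn => (hc n hn).mono fun ω hω => hω.symm
    exact ⟨h1, by simpa using h2⟩
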